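/- Let $U\subseteq\mathbb{R}^q$ be open and let $\mathcal{A}^i=(\mathcal{A}^{\mu i}_\alpha):U\to\mathbb{R}^{m\times q}$, $i=1,\dots,p$, be smooth. Consider the first-order quasilinear system $$\mathcal{A}^{\mu i}_\alpha(u)\,u^\alpha_i=0,\qquad \mu=1,\dots,m,\qquad u^\alpha_i=\partial u^\alpha/\partial x^i,\quad x\in\mathbb{R}^p,\ u\in U\qquad(1)$$ (repeated indices are summed). Let $\lambda^1,\dots,\lambda^k:U\to\mathbb{C}^p$ be smooth wave vectors, i.e. $\operatorname{rank}\big(\lambda^A_i(u)\mathcal{A}^i(u)\big)<\min(m,q)$, such that $\lambda^1(u),\dots,\lambda^k(u),\bar\lambda^1(u),\dots,\bar\lambda^k(u)$ are linearly independent over $\mathbb{C}$ for every $u\in U$. Let $\Lambda(u)\in\mathbb{C}^{2k\times p}$ be the matrix with these $2k$ rows and $\Lambda_i$ its $i$-th column, and let $r^A(x,u)=\lambda^A_i(u)x^i$ be the Riemann invariants. Let $X_a=\xi_a^i(u)\partial_{x^i}$, $a=1,\dots,p-2k$, be vector fields with smooth $\xi_a:U\to\mathbb{C}^p$, pointwise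 linearly independent and orthogonal to the wave vectors: $\lambda^A_i\xi^i_a=\bar\lambda^A_i\xi^i_a=0$. In the space of first jets $(x,u,(u^\alpha_i))$ with $u\in U$ let $S$ be the set of the jets that satisfy (1) and $\xi^i_a(u)u^\alpha_i=0$ for all $a,\alpha$. Assume that (1) is nondegenerate on $S$: at each jet of $S$ the left-hand side of (1) has maximal rank, and each jet of $S$ is the first jet of a local smooth solution of (1). The fields $X_a$ generate a $(p-2k)$-dimensional Abelian conditional symmetry algebra of (1) over $N\subseteq\mathbb{R}^p\times U$ if over $N$ they are linearly independent over $\mathbb{C}$, $[X_a,X_b]=0$, and $\operatorname{pr}^{(1)}X_a(\mathcal{A}^iu_i)=0$ at all jets of $S$ over $N$, where $\operatorname{pr}^{(1)}X_a=X_a-\frac{\partial\xi_a^i}{\partial u^\beta}u^\beta_ju^\alpha_i\frac{\partial}{\partial u^\alpha_j}$. For a smooth function $f(r,\bar r)$ with values in $\mathbb{C}^q$ put $$P=\frac{\partial f}{\partial R}+\frac{\partial\bar f}{\partial R}\in\mathbb{C}^{q\times2k},\qquad R=(r^1,\dots,r^k,\bar r^1,\dots,\bar r^k),\qquad \eta_a=\xi_a^i(u)\frac{\partial\Lambda_i}{\partial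 u}\in\mathbb{C}^{2k\times q},\qquad \mathcal{A}^\mu=(\mathcal{A}^{\mu i}_\alpha)\in\mathbb{R}^{p\times q}.$$ Let $M$ be either of the numbers $q$ and $2k$. (a) Let $(x_0,u_0)\in\mathbb{R}^p\times U$. The following are equivalent: (i) $X_1,\dots,X_{p-2k}$ generate a $(p-2k)$-dimensional Abelian conditional symmetry algebra of (1) over some neighbourhood of $(x_0,u_0)$; (ii) near $(x_0,u_0)$ the system (1) admits a $(p-2k)$-dimensional Abelian conditional symmetry algebra generated by some smooth, pointwise linearly independent fields $\tilde\xi_a^i(u)\partial_{x^i}$ orthogonal to all $\lambda^A,\bar\lambda^A$; (iii) there is a neighbourhood of $(x_0,u_0)$ such that for each jet $(x,u,(u^\alpha_i))\in S$ over it and each smooth $f$ with $f+\bar f=u$ and $P\Lambda(u)=(u^\alpha_i)$ at $r=r(x,u)$, the initial-value condition $$\operatorname{tr}\big(\mathcal{A}^\mu P\Lambda\big)=0,\qquad \mu=1,\dots,m,$$ and the propagation conditions $$\operatorname{tr}\big(\mathcal{A}^\mu P\,\eta_{(a_1}P\,\eta_{a_2}P\cdots\eta_{a_s)}P\,\Lambda\big)=0,\qquad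 \mu=1,\dots,m,\quad 1\le s\le M-1,\quad 1\le a_1,\dots,a_s\le p-2k,$$ hold at this point, where $(a_1\dots a_s)$ denotes symmetrization. (b) Let $u$ be a smooth $U$-valued solution of (1) on an open set containing the origin $x=0$. Its graph is invariant under $X_1,\dots,X_{p-2k}$ near the origin, i.e. $\xi^i_a(u)u^\alpha_i=0$ there, if and only if near the origin $u$ is a $k$-mode solution, i.e. $u=f(r(x,u),\bar r(x,u))+c.c.$ for some smooth $\mathbb{C}^q$-valued function $f$ defined on an open subset of $\mathbb{C}^k$. -/

import Mathlib

open Set Topology Matrix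
open scoped ContDiff

noncomputable section

namespace QuasilinearSystem

/-- First jets `(x, u, L)` of maps from `ℝ^p` to `ℝ^q`; the entry `L α i` is the coordinate
`u^α_i`, which stands for `∂u^α/∂x^i`. -/
abbrev Jet (p q : ℕ) : Type :=
  (Fin p → ℝ) × (Fin q → ℝ) × (Fin q → Fin p → ℝ)

/-- The partial derivative `∂g/∂u^β` of a complex-valued function `g` of the dependent
variables. -/
def partialU {q : ℕ} (g : (Fin q → ℝ) → ℂ) (β : Fin q) (u : Fin q → ℝ) : ℂ :=
  fderiv ℝ g u (Pi.single β 1)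

/-! ### The system and its solutions -/

/-- The left-hand side `Δ^μ = ∑_i ∑_α A^{μ i}_α(u) u^α_i` of the system, as a function on the
first jet space. The coefficient `A^{μ i}_α(u)` is `A i u μ α`. -/
def systemMap {p q m : ℕ} (A : Fin p → (Fin q → ℝ) → Matrix (Fin m) (Fin q) ℝ)
    (z : Jet p q) : Fin m → ℝ :=
  fun μ => ∑ i, ∑ α, A i z.2.1 μ α * z.2.2 α i

/-- The first jet of the map `u` at the point `x`. -/
def jetOf {p q : ℕ} (u : (Fin p → ℝ) → (Fin q → ℝ)) (x : Fin p → ℝ) : Jet p q :=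
  (x, u x, fun α i => fderiv ℝ u x (Pi.single i 1) α)

/-- `u` is a smooth solution of `A^i(u) u_i = 0` on the set `D`, with values in `U`. -/
structure IsSolutionOn {p q m : ℕ} (A : Fin p → (Fin q → ℝ) → Matrix (Fin m) (Fin q) ℝ)
    (U : Set (Fin q → ℝ)) (u : (Fin p → ℝ) → (Fin q → ℝ)) (D : Set (Fin p → ℝ)) : Prop where
  smooth : ContDiffOn ℝ ∞ u D
  mapsTo : MapsTo u D U
  equation : ∀ x ∈ D, systemMap A (jetOf u x) = 0

/-- The subset of the jet space (over `U`) defined by the system. -/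
def SDelta {p q m : ℕ} (A : Fin p → (Fin q → ℝ) → Matrix (Fin m) (Fin q) ℝ)
    (U : Set (Fin q → ℝ)) : Set (Jet p q) :=
  {z | z.2.1 ∈ U ∧ systemMap A z = 0}

/-- The subset of the jet space defined by the invariance conditions `ξ_a^i(u) u^α_i = 0`. -/
def SQ {p q n : ℕ} (ξ : Fin n → (Fin q → ℝ) → (Fin p → ℂ)) : Set (Jet p q) :=
  {z | ∀ (a : Fin n) (α : Fin q), ∑ i, ξ a z.2.1 i * (z.2.2 α i : ℂ) = 0}

/-- The system is nondegenerate at the jet `z`: it is of maximal rank there, and it is locally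
solvable there, that is, `z` is the first jet of a local smooth solution. -/
structure IsNondegenerateAt {p q m : ℕ}
    (A : Fin p → (Fin q → ℝ) → Matrix (Fin m) (Fin q) ℝ)
    (U : Set (Fin q → ℝ)) (z : Jet p q) : Prop where
  maximalRank : Function.Surjective (fderiv ℝ (systemMap A) z)
  locallySolvable : ∃ (D : Set (Fin p → ℝ)) (u : (Fin p → ℝ) → (Fin q → ℝ)),
    IsOpen D ∧ z.1 ∈ D ∧ IsSolutionOn A U u D ∧ jetOf u z.1 = z

/-! ### Wave vectors, Riemann invariants and orthogonal vector fields -/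

/-- The `2k × p` matrix `Λ(u)` whose rows are `λ^1, …, λ^k` followed by their conjugates. -/
def waveMatrix {p q k : ℕ} (lam : Fin k → (Fin q → ℝ) → (Fin p → ℂ)) (u : Fin q → ℝ) :
    Matrix (Fin k ⊕ Fin k) (Fin p) ℂ :=
  Matrix.of (Sum.elim (fun B i => lam B u i) (fun B i => star (lam B u i)))

/-- `λ^1, …, λ^k` are smooth complex wave vectors of the system on `U`: they satisfy the
dispersion relation `rank (λ_i A^i(u)) < min (m, q)`, and together with their complex conjugates
they are linearly independent over `ℂ`. -/
structure IsWaveSystem {p q m k : ℕ} (A : Fin p → (Fin q → ℝ) → Matrix (Fin m) (Fin q) ℝ)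
    (lam : Fin k → (Fin q → ℝ) → (Fin p → ℂ)) (U : Set (Fin q → ℝ)) : Prop where
  smooth : ∀ B, ContDiffOn ℝ ∞ (lam B) U
  dispersion : ∀ u ∈ U, ∀ B,
    (∑ i, lam B u i • (A i u).map (fun t : ℝ => (t : ℂ))).rank < min m q
  independent : ∀ u ∈ U, LinearIndependent ℂ (fun s => waveMatrix lam u s)

/-- The Riemann invariants `r^B(x, u) = λ^B_i(u) x^i`. -/
def riemannInvariant {p q k : ℕ} (lam : Fin k → (Fin q → ℝ) → (Fin p → ℂ))
    (x : Fin p → ℝ) (u : Fin q → ℝ) : Fin k → ℂ :=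
  fun B => ∑ i, lam B u i * (x i : ℂ)

/-- The fields `ξ_1, …, ξ_n` are smooth on `U`, linearly independent at each point, and
orthogonal to all `λ^B` and to all their conjugates. -/
structure IsOrthogonalFrame {p q k n : ℕ} (lam : Fin k → (Fin q → ℝ) → (Fin p → ℂ))
    (ξ : Fin n → (Fin q → ℝ) → (Fin p → ℂ)) (U : Set (Fin q → ℝ)) : Prop where
  smooth : ∀ a, ContDiffOn ℝ ∞ (ξ a) U
  independent : ∀ u ∈ U, LinearIndependent ℂ (fun a => ξ a u)
  orthogonal : ∀ u ∈ U, ∀ B a, ∑ i, lam B u i * ξ a u i = 0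
  orthogonal_conj : ∀ u ∈ U, ∀ B a, ∑ i, star (lam B u i) * ξ a u i = 0

/-! ### Conditional symmetry algebras -/

/-- A vector field on `X × U` with complex coefficients. -/
abbrev CField (p q : ℕ) : Type :=
  (Fin p → ℝ) × (Fin q → ℝ) → (Fin p → ℂ) × (Fin q → ℂ)

/-- The field `X_a = ξ_a^i(u) ∂/∂x^i`. -/
def fieldX {p q n : ℕ} (ξ : Fin n → (Fin q → ℝ) → (Fin p → ℂ)) (a : Fin n) : CField p q :=
  fun y => (ξ a y.2, 0)

/-- The value at `y` of `V(g)`, for a complex vector field `V` and a function `g` on `X × U`. -/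
def applyField {p q : ℕ} (V : CField p q) (g : (Fin p → ℝ) × (Fin q → ℝ) → ℂ)
    (y : (Fin p → ℝ) × (Fin q → ℝ)) : ℂ :=
  ∑ i, (V y).1 i * fderiv ℝ g y (Pi.single i 1, 0)
    + ∑ α, (V y).2 α * fderiv ℝ g y (0, Pi.single α 1)

/-- The Lie bracket of two complex vector fields on `X × U`. -/
def bracket {p q : ℕ} (V W : CField p q) : CField p q :=
  fun y =>
    (fun i => applyField V (fun t => (W t).1 i) y - applyField W (fun t => (V t).1 i) y,
     fun α => applyField V (fun t => (W t).2 α) y - applyField W (fun t => (V t).2 α) y)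

/-- The action on a function `F` on the jet space of the first prolongation
`pr X_a = ξ_a^i ∂/∂x^i - (∂ξ_a^i/∂u^β) u^β_j u^α_i ∂/∂u^α_j`. -/
def prolongation {p q n : ℕ} (ξ : Fin n → (Fin q → ℝ) → (Fin p → ℂ)) (a : Fin n)
    (F : Jet p q → ℝ) (z : Jet p q) : ℂ :=
  ∑ i, ξ a z.2.1 i * (fderiv ℝ F z (Pi.single i 1, 0, 0) : ℂ)
    - ∑ α, ∑ j,
      (∑ i, ∑ β, partialU (fun u => ξ a u i) β z.2.1 * (z.2.2 β j : ℂ) * (z.2.2 α i : ℂ))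
        * (fderiv ℝ F z (0, 0, Pi.single α (Pi.single j 1)) : ℂ)

/-- Over the set `N ⊆ X × U`, the fields `X_1, …, X_n` span an `n`-dimensional Abelian Lie
algebra, and it is a conditional symmetry algebra of the system: `pr X_a (A^i u_i)` vanishes at
all the jets over `N` that satisfy both the system and the invariance conditions. -/
structure IsConditionalSymmetryAlgebraOn {p q m n : ℕ}
    (A : Fin p → (Fin q → ℝ) → Matrix (Fin m) (Fin q) ℝ) (U : Set (Fin q → ℝ))
    (ξ : Fin n → (Fin q → ℝ) → (Fin p → ℂ)) (N : Set ((Fin p → ℝ) × (Fin q → ℝ))) : Prop where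
  dimension : LinearIndependent ℂ (fun (a : Fin n) (y : N) => fieldX ξ a y)
  abelian : ∀ a b, ∀ y ∈ N, bracket (fieldX ξ a) (fieldX ξ b) y = 0
  symmetric : ∀ z ∈ SDelta A U ∩ SQ ξ, (z.1, z.2.1) ∈ N →
    ∀ a μ, prolongation ξ a (fun w => systemMap A w μ) z = 0

/-- The fields `X_a` generate an `n`-dimensional Abelian conditional symmetry algebra on some
neighbourhood of `y₀ = (x₀, u₀)`. -/
def GeneratesSymmetryAlgebraNear {p q m n : ℕ}
    (A : Fin p → (Fin q → ℝ) → Matrix (Fin m) (Fin q) ℝ) (U : Set (Fin q → ℝ))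
    (ξ : Fin n → (Fin q → ℝ) → (Fin p → ℂ)) (y₀ : (Fin p → ℝ) × (Fin q → ℝ)) : Prop :=
  ∃ N ∈ 𝓝 y₀, N ⊆ univ ×ˢ U ∧ IsConditionalSymmetryAlgebraOn A U ξ N

/-- Near `y₀ = (x₀, u₀)` the system admits a `(p - 2k)`-dimensional Abelian conditional symmetry
algebra generated by some fields `ξ_a^i(u) ∂/∂x^i` orthogonal to the wave vectors and their
conjugates. -/
def AdmitsSymmetryAlgebraNear {p q m k : ℕ}
    (A : Fin p → (Fin q → ℝ) → Matrix (Fin m) (Fin q) ℝ)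
    (lam : Fin k → (Fin q → ℝ) → (Fin p → ℂ)) (U : Set (Fin q → ℝ))
    (y₀ : (Fin p → ℝ) × (Fin q → ℝ)) : Prop :=
  ∃ (U' : Set (Fin q → ℝ)) (ξ : Fin (p - 2 * k) → (Fin q → ℝ) → (Fin p → ℂ)),
    IsOpen U' ∧ y₀.2 ∈ U' ∧ U' ⊆ U ∧ IsOrthogonalFrame lam ξ U' ∧
      GeneratesSymmetryAlgebraNear A U' ξ y₀

/-! ### The trace conditions -/

/-- The `q × 2k` matrix `∂f/∂R = (∂f/∂r, ∂f/∂r̄)` of the Wirtinger derivatives of a function `f`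
of the complex variables `r^1, …, r^k`. -/
def derivR {q k : ℕ} (f : (Fin k → ℂ) → (Fin q → ℂ)) (r : Fin k → ℂ) :
    Matrix (Fin q) (Fin k ⊕ Fin k) ℂ :=
  Matrix.of fun α => Sum.elim
    (fun B => (fderiv ℝ f r (Pi.single B 1) α
      - Complex.I * fderiv ℝ f r (Pi.single B Complex.I) α) / 2)
    (fun B => (fderiv ℝ f r (Pi.single B 1) α
      + Complex.I * fderiv ℝ f r (Pi.single B Complex.I) α) / 2)

/-- The matrix `∂f/∂R + ∂f̄/∂R`. -/
def profileMatrix {q k : ℕ} (f : (Fin k → ℂ) → (Fin q → ℂ)) (r : Fin k → ℂ) :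
    Matrix (Fin q) (Fin k ⊕ Fin k) ℂ :=
  derivR f r + derivR (fun t => star (f t)) r

/-- The `p × q` matrix `A^μ = (A^{μ i}_α(u))`. -/
def coeffMatrix {p q m : ℕ} (A : Fin p → (Fin q → ℝ) → Matrix (Fin m) (Fin q) ℝ) (μ : Fin m)
    (u : Fin q → ℝ) : Matrix (Fin p) (Fin q) ℂ :=
  Matrix.of fun i α => (A i u μ α : ℂ)

/-- The `2k × q` matrix `η_a = ξ_a^i(u) ∂Λ_i/∂u`, the derivative of `∂R/∂u = (∂Λ_i/∂u) x^i` along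
`X_a`. When `2k` columns of `Λ` form the identity matrix and `X_a` is the field
`∂/∂x^{i_a} - (combination of the ∂/∂x^i of these columns)`, it is `∂Λ_{i_a}/∂u`. -/
def etaMatrix {p q k n : ℕ} (lam : Fin k → (Fin q → ℝ) → (Fin p → ℂ))
    (ξ : Fin n → (Fin q → ℝ) → (Fin p → ℂ)) (a : Fin n) (u : Fin q → ℝ) :
    Matrix (Fin k ⊕ Fin k) (Fin q) ℂ :=
  Matrix.of fun s β => ∑ i, ξ a u i * partialU (fun v => waveMatrix lam v s i) β u

/-- The initial-value condition `tr (A^μ (∂f/∂R + ∂f̄/∂R) Λ) = 0` for all `μ`, with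
`P = ∂f/∂R + ∂f̄/∂R`. -/
def InitialCondition {p q m k : ℕ} (A : Fin p → (Fin q → ℝ) → Matrix (Fin m) (Fin q) ℝ)
    (lam : Fin k → (Fin q → ℝ) → (Fin p → ℂ)) (u : Fin q → ℝ)
    (P : Matrix (Fin q) (Fin k ⊕ Fin k) ℂ) : Prop :=
  ∀ μ, (coeffMatrix A μ u * P * waveMatrix lam u).trace = 0

/-- The propagation condition of order `s`:
`tr (A^μ P η_{(a_1} P η_{a_2} P … η_{a_s)} P Λ) = 0` for all `μ` and `a_1, …, a_s`, with the
indices symmetrized and `P = ∂f/∂R + ∂f̄/∂R`. -/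
def PropagationCondition {p q m k n : ℕ} (A : Fin p → (Fin q → ℝ) → Matrix (Fin m) (Fin q) ℝ)
    (lam : Fin k → (Fin q → ℝ) → (Fin p → ℂ)) (ξ : Fin n → (Fin q → ℝ) → (Fin p → ℂ))
    (u : Fin q → ℝ) (P : Matrix (Fin q) (Fin k ⊕ Fin k) ℂ) (s : ℕ) : Prop :=
  ∀ μ, ∀ a : Fin s → Fin n,
    ∑ σ : Equiv.Perm (Fin s),
      (coeffMatrix A μ u * (List.ofFn fun j => P * etaMatrix lam ξ (a (σ j)) u).prod
        * P * waveMatrix lam u).trace = 0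

/-- On some neighbourhood of `y₀ = (x₀, u₀)` the trace conditions hold along the jets `(x, u, L)`
which satisfy the system and the invariance conditions: for each smooth `f` with
`f(r) + c.c. = u` and `(∂f/∂R + ∂f̄/∂R) Λ(u) = L` at `r = r(x, u)`, the initial-value condition
and the propagation conditions of the orders `1 ≤ s ≤ M - 1` hold. -/
def TraceConditionsNear {p q m k n : ℕ} (M : ℕ)
    (A : Fin p → (Fin q → ℝ) → Matrix (Fin m) (Fin q) ℝ)
    (lam : Fin k → (Fin q → ℝ) → (Fin p → ℂ)) (U : Set (Fin q → ℝ))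
    (ξ : Fin n → (Fin q → ℝ) → (Fin p → ℂ)) (y₀ : (Fin p → ℝ) × (Fin q → ℝ)) : Prop :=
  ∃ N ∈ 𝓝 y₀, N ⊆ univ ×ˢ U ∧
    ∀ z ∈ SDelta A U ∩ SQ ξ, (z.1, z.2.1) ∈ N →
      ∀ f : (Fin k → ℂ) → (Fin q → ℂ),
        ContDiffAt ℝ ∞ f (riemannInvariant lam z.1 z.2.1) →
        (∀ α, (z.2.1 α : ℂ) = f (riemannInvariant lam z.1 z.2.1) α
          + star (f (riemannInvariant lam z.1 z.2.1) α)) →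
        profileMatrix f (riemannInvariant lam z.1 z.2.1) * waveMatrix lam z.2.1
          = Matrix.of (fun α i => (z.2.2 α i : ℂ)) →
        InitialCondition A lam z.2.1 (profileMatrix f (riemannInvariant lam z.1 z.2.1)) ∧
        ∀ s, 1 ≤ s → s < M → PropagationCondition A lam ξ z.2.1
          (profileMatrix f (riemannInvariant lam z.1 z.2.1)) s

/-! ### Invariant maps and multimode maps -/

/-- The graph of `u` over `V` is invariant under the fields `X_a`: the vector `(ξ_a(u(x)), 0)` is
tangent to the graph at `(x, u(x))`, that is, `ξ_a^i(u) ∂u^α/∂x^i = 0` on `V`. -/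
def IsInvariantOn {p q n : ℕ} (ξ : Fin n → (Fin q → ℝ) → (Fin p → ℂ))
    (u : (Fin p → ℝ) → (Fin q → ℝ)) (V : Set (Fin p → ℝ)) : Prop :=
  ∀ x ∈ V, jetOf u x ∈ SQ ξ

/-- On `V` the map `u` is of the form `u = f(r(x,u), r̄(x,u)) + c.c.` with a smooth function `f`
(smooth in the real sense, so that it is a function of `r` and `r̄`). -/
def IsModeFormOn {p q k : ℕ} (lam : Fin k → (Fin q → ℝ) → (Fin p → ℂ))
    (u : (Fin p → ℝ) → (Fin q → ℝ)) (V : Set (Fin p → ℝ)) : Prop :=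
  ∃ (O : Set (Fin k → ℂ)) (f : (Fin k → ℂ) → (Fin q → ℂ)), IsOpen O ∧ ContDiffOn ℝ ∞ f O ∧
    ∀ x ∈ V, riemannInvariant lam x (u x) ∈ O ∧
      ∀ α, (u x α : ℂ) = f (riemannInvariant lam x (u x)) α
        + star (f (riemannInvariant lam x (u x)) α)

end QuasilinearSystem

end

/-!
Let `W u` be the space of the complex matrices `P` for which `P Λ(u)` solves the system
algebraically. The gradients of the jets of `S` over `u` are the matrices `P Λ(u)` with `P ∈ W u`
that are real, and differentiating `Λ Ξᵀ = 0` turns the prolongation of `X_a` at such a jet into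
`tr (A^μ P η_a P Λ)`. Hence the symmetry criterion says that `W u` is stable under the maps
`P ↦ P η_a P`. Polarization then puts all symmetrized words `P η P ⋯ η P` into `W u`, so that the
propagation conditions of order one imply the others. Since stability depends only on the span of
the `ξ_a`, which the wave vectors determine, the choice of the frame is irrelevant.

For the invariant solutions, `r(x, u(x)) = Λ(u(x)) x` has the derivative `Λ(u(0))` at the origin
and is thus a submersion there. Invariance makes `u` constant along its fibres, hence a function of
`r`. Conversely, if `u = g(r)` and `Λ(u(x)) w = 0`, then `du(w)` is a fixed point of a linear map
of norm `O(|x|)`, so it vanishes near the origin.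
-/

noncomputable section

namespace QuasilinearSystem

section LinearAlgebra

variable {K ι κ ν : Type*} [Field K] [Fintype ι]

theorem mul_left_injective_of_linearIndependent_row {B : Matrix ι ν K}
    (hB : LinearIndependent K B.row) {ο : Type*} :
    Function.Injective fun P : Matrix ο ι K => P * B :=
  fun _ _ h => funext fun α => vecMul_injective_iff.2 hB (congrFun h α)

variable [Fintype κ] [Fintype ν]

theorem span_range_eq_ker_mulVecLin {C : Matrix κ ν K} (hC : LinearIndependent K C.row)
    {b : ι → ν → K} (hb : LinearIndependent K b)
    (hcard : Fintype.card ι + Fintype.card κ = Fintype.card ν) (hCb : ∀ i, C *ᵥ b i = 0) :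
    Submodule.span K (range b) = C.mulVecLin.ker := by
  refine Submodule.eq_of_le_of_finrank_eq ?_ ?_
  · rw [Submodule.span_le, range_subset_iff]
    exact hCb
  · have hrank : Module.finrank K C.mulVecLin.range = Fintype.card κ := hC.rank_matrix
    have hnullity := C.mulVecLin.finrank_range_add_finrank_ker
    rw [Module.finrank_fintype_fun_eq_card] at hnullity
    rw [finrank_span_eq_card hb]
    omega

theorem exists_mul_eq_iff_mul_transpose_eq_zero {B : Matrix ι ν K} {C : Matrix κ ν K}
    (hB : LinearIndependent K B.row) (hC : LinearIndependent K C.row)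
    (hcard : Fintype.card ι + Fintype.card κ = Fintype.card ν) (hBC : B * Cᵀ = 0)
    {ο : Type*} {M : Matrix ο ν K} : (∃ P : Matrix ο ι K, P * B = M) ↔ M * Cᵀ = 0 := by
  refine ⟨fun ⟨P, hP⟩ => by rw [← hP, Matrix.mul_assoc, hBC, Matrix.mul_zero], fun hM => ?_⟩
  have hker : B.vecMulLinear.range = C.mulVecLin.ker := by
    rw [range_vecMulLinear]
    refine span_range_eq_ker_mulVecLin hC hB hcard fun i => ?_
    rw [← vecMul_transpose]
    exact congrFun hBC i
  have hrow : ∀ α, ∃ t : ι → K, t ᵥ* B = M α := fun α => by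
    have hα : M α ∈ C.mulVecLin.ker := by
      rw [LinearMap.mem_ker, mulVecLin_apply, ← vecMul_transpose]
      exact congrFun hM α
    rwa [← hker] at hα
  choose P hP using hrow
  exact ⟨Matrix.of P, funext hP⟩

end LinearAlgebra

theorem eq_trace_smul_one {R ι : Type*} [NonAssocSemiring R] [Fintype ι] [DecidableEq ι]
    [Subsingleton ι] (M : Matrix ι ι R) : M = M.trace • (1 : Matrix ι ι R) := by
  ext i j
  rw [Subsingleton.elim j i, Matrix.smul_apply, Matrix.one_apply_eq, smul_eq_mul, mul_one]
  exact (Fintype.sum_subsingleton M.diag i).symm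

section SymmetrizedWords

variable {R ι κ : Type*} [Fintype ι] [Fintype κ]

theorem mul_mul_add_mul_mul_mem [Ring R] {W : AddSubgroup (Matrix ι κ R)} {H : Matrix κ ι R}
    {P Q : Matrix ι κ R} (hP : P * H * P ∈ W) (hQ : Q * H * Q ∈ W)
    (hPQ : (P + Q) * H * (P + Q) ∈ W) : P * H * Q + Q * H * P ∈ W := by
  convert W.sub_mem (W.sub_mem hPQ hP) hQ using 1
  simp only [Matrix.add_mul, Matrix.mul_add]
  abel

variable [DecidableEq ι] [Semiring R]

/-- The symmetrization `∑_σ P η_{σ(1)} P ⋯ η_{σ(s)} P` (without the factor `1 / s!`) of the word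
alternating the matrix `P` with the members of the family `η`. -/
def symWord {s : ℕ} (P : Matrix ι κ R) (η : Fin s → Matrix κ ι R) : Matrix ι κ R :=
  ∑ σ : Equiv.Perm (Fin s), (List.ofFn fun j => P * η (σ j)).prod * P

theorem symWord_succ_left {s : ℕ} (P : Matrix ι κ R) (η : Fin (s + 1) → Matrix κ ι R) :
    symWord P η = ∑ j, P * η j * symWord P fun i => η (Equiv.swap 0 j i.succ) := by
  rw [symWord, ← Equiv.Perm.decomposeFin.symm.sum_comp, Fintype.sum_prod_type]
  simp only [symWord, List.ofFn_succ, List.prod_cons, Equiv.Perm.decomposeFin_symm_apply_zero,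
    Equiv.Perm.decomposeFin_symm_apply_succ, Matrix.mul_sum, Matrix.mul_assoc]

theorem symWord_succ_right {s : ℕ} (P : Matrix ι κ R) (η : Fin (s + 1) → Matrix κ ι R) :
    symWord P η = ∑ j, (symWord P fun i => η (Equiv.swap 0 j i.succ)) * η j * P := by
  rw [symWord, ← Equiv.sum_comp (Equiv.mulRight (finRotate (s + 1))),
    ← Equiv.Perm.decomposeFin.symm.sum_comp, Fintype.sum_prod_type]
  simp only [symWord, List.ofFn_succ', List.concat_eq_append, List.prod_append,
    List.prod_singleton, Equiv.coe_mulRight, Equiv.Perm.mul_apply, finRotate_apply,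
    Fin.last_add_one, Fin.coeSucc_eq_succ, Equiv.Perm.decomposeFin_symm_apply_zero,
    Equiv.Perm.decomposeFin_symm_apply_succ, Matrix.sum_mul, Matrix.mul_assoc]

theorem symWord_mem {K : Type*} [Field K] [NeZero (2 : K)] {W : Submodule K (Matrix ι κ K)} {s : ℕ}
    {η : Fin s → Matrix κ ι K} (hW : ∀ j, ∀ P ∈ W, P * η j * P ∈ W)
    {P : Matrix ι κ K} (hP : P ∈ W) : symWord P η ∈ W := by
  induction s with
  | zero => simpa [symWord] using hP
  | succ s ih =>
    have htwice : (2 : K) • symWord P η = ∑ j,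
        (P * η j * (symWord P fun i => η (Equiv.swap 0 j i.succ))
          + (symWord P fun i => η (Equiv.swap 0 j i.succ)) * η j * P) := by
      rw [two_smul, Finset.sum_add_distrib, ← symWord_succ_left, ← symWord_succ_right]
    rw [← W.smul_mem_iff (two_ne_zero (α := K)), htwice]
    refine W.sum_mem fun j _ => ?_
    have hword : symWord P (fun i => η (Equiv.swap 0 j i.succ)) ∈ W := ih fun i => hW _
    exact mul_mul_add_mul_mul_mem (W := W.toAddSubgroup) (hW j _ hP) (hW j _ hword)
      (hW j _ (W.add_mem hP hword))

end SymmetrizedWords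

section Profiles

variable {p q m k n : ℕ} {A : Fin p → (Fin q → ℝ) → Matrix (Fin m) (Fin q) ℝ}
  {lam : Fin k → (Fin q → ℝ) → (Fin p → ℂ)} {ξ : Fin n → (Fin q → ℝ) → (Fin p → ℂ)}
  {U : Set (Fin q → ℝ)} {u : Fin q → ℝ}

/-- The matrix `Ξ(u)` with the rows `ξ_1(u), …, ξ_n(u)`; the orthogonality of the frame reads
`Ξ Λᵀ = 0`. -/
def frameMatrix (ξ : Fin n → (Fin q → ℝ) → (Fin p → ℂ)) (u : Fin q → ℝ) :
    Matrix (Fin n) (Fin p) ℂ :=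
  Matrix.of fun a i => ξ a u i

theorem IsOrthogonalFrame.waveMatrix_mulVec (hξ : IsOrthogonalFrame lam ξ U) (hu : u ∈ U)
    (a : Fin n) : waveMatrix lam u *ᵥ ξ a u = 0 := by
  ext (B | B)
  · exact hξ.orthogonal u hu B a
  · exact hξ.orthogonal_conj u hu B a

theorem IsOrthogonalFrame.waveMatrix_mul_transpose (hξ : IsOrthogonalFrame lam ξ U)
    (hu : u ∈ U) : waveMatrix lam u * (frameMatrix ξ u)ᵀ = 0 :=
  Matrix.ext fun s a => congrFun (hξ.waveMatrix_mulVec hu a) s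

theorem IsOrthogonalFrame.frameMatrix_mul_transpose (hξ : IsOrthogonalFrame lam ξ U)
    (hu : u ∈ U) : frameMatrix ξ u * (waveMatrix lam u)ᵀ = 0 := by
  simpa using congrArg Matrix.transpose (hξ.waveMatrix_mul_transpose hu)

theorem mem_SQ_iff {x : Fin p → ℝ} {L : Fin q → Fin p → ℝ} :
    (x, u, L) ∈ SQ ξ ↔ (Matrix.of L).map Complex.ofReal * (frameMatrix ξ u)ᵀ = 0 := by
  rw [← Matrix.ext_iff, forall_comm]
  simp only [SQ, frameMatrix, Matrix.mul_apply, Matrix.map_apply, Matrix.transpose_apply,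
    Matrix.of_apply, Matrix.zero_apply, mul_comm, mem_ofPred_eq]

theorem card_add_card_of_linearIndependent
    (hΛ : LinearIndependent ℂ fun s => waveMatrix lam u s) :
    Fintype.card (Fin k ⊕ Fin k) + Fintype.card (Fin (p - 2 * k)) = Fintype.card (Fin p) := by
  have := hΛ.fintype_card_le_finrank
  simp only [Fintype.card_sum, Fintype.card_fin, Module.finrank_fintype_fun_eq_card] at this ⊢
  omega

theorem waveMatrix_map_conj (lam : Fin k → (Fin q → ℝ) → (Fin p → ℂ)) (u : Fin q → ℝ) :
    (waveMatrix lam u).map (starRingEnd ℂ) = (waveMatrix lam u).submatrix Sum.swap id := by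
  ext (B | B) i <;> simp [waveMatrix]

/-- The conjugation of profile matrices: it conjugates the entries and exchanges the derivatives
along `r` and `r̄`, so that it corresponds to entrywise conjugation of `P Λ`. -/
def conjProfile {ι κ : Type*} (P : Matrix ι (κ ⊕ κ) ℂ) : Matrix ι (κ ⊕ κ) ℂ :=
  (P.map (starRingEnd ℂ)).submatrix id Sum.swap

theorem conjProfile_conjProfile {ι κ : Type*} (P : Matrix ι (κ ⊕ κ) ℂ) :
    conjProfile (conjProfile P) = P := by
  ext
  simp [conjProfile]

theorem conjProfile_add {ι κ : Type*} (P Q : Matrix ι (κ ⊕ κ) ℂ) :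
    conjProfile (P + Q) = conjProfile P + conjProfile Q := by
  ext
  simp [conjProfile]

theorem conjProfile_sub {ι κ : Type*} (P Q : Matrix ι (κ ⊕ κ) ℂ) :
    conjProfile (P - Q) = conjProfile P - conjProfile Q := by
  ext
  simp [conjProfile]

theorem conjProfile_smul {ι κ : Type*} (c : ℂ) (P : Matrix ι (κ ⊕ κ) ℂ) :
    conjProfile (c • P) = starRingEnd ℂ c • conjProfile P := by
  ext
  simp [conjProfile]

theorem conjProfile_mul_waveMatrix {ι : Type*} (P : Matrix ι (Fin k ⊕ Fin k) ℂ) :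
    conjProfile P * waveMatrix lam u = (P * waveMatrix lam u).map (starRingEnd ℂ) := by
  rw [Matrix.map_mul, waveMatrix_map_conj, conjProfile]
  ext α i
  simp only [Matrix.mul_apply]
  exact Fintype.sum_equiv (Equiv.sumComm _ _) _ _ fun s => by simp

theorem conjProfile_eq_self_iff {ι : Type*} (hΛ : LinearIndependent ℂ fun s => waveMatrix lam u s)
    {P : Matrix ι (Fin k ⊕ Fin k) ℂ} :
    conjProfile P = P ↔ ∃ L : ι → Fin p → ℝ,
      P * waveMatrix lam u = (Matrix.of L).map Complex.ofReal := by
  have hreal : conjProfile P = P ↔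
      (P * waveMatrix lam u).map (starRingEnd ℂ) = P * waveMatrix lam u := by
    rw [← conjProfile_mul_waveMatrix]
    exact ((mul_left_injective_of_linearIndependent_row hΛ).eq_iff).symm
  rw [hreal]
  constructor
  · intro h
    refine ⟨fun α i => ((P * waveMatrix lam u) α i).re, ?_⟩
    ext α i
    exact (Complex.conj_eq_iff_re.1 (congrFun (congrFun h α) i)).symm
  · rintro ⟨L, hL⟩
    rw [hL]
    ext α i
    exact Complex.conj_ofReal _

theorem trace_coeffMatrix_mul_map_ofReal (μ : Fin m) (x : Fin p → ℝ) (L : Fin q → Fin p → ℝ) :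
    (coeffMatrix A μ u * (Matrix.of L).map Complex.ofReal).trace = systemMap A (x, u, L) μ := by
  simp [Matrix.trace, Matrix.mul_apply, coeffMatrix, systemMap]

/-- The space of the profile matrices `P` with `tr (A^μ P Λ) = 0` for all `μ`, that is, for which
`P Λ` solves the system. -/
def solutionProfiles (A : Fin p → (Fin q → ℝ) → Matrix (Fin m) (Fin q) ℝ)
    (lam : Fin k → (Fin q → ℝ) → (Fin p → ℂ)) (u : Fin q → ℝ) :
    Submodule ℂ (Matrix (Fin q) (Fin k ⊕ Fin k) ℂ) where
  carrier := {P | InitialCondition A lam u P}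
  add_mem' := fun {P Q} hP hQ μ => by
    rw [Matrix.mul_add, Matrix.add_mul, Matrix.trace_add, hP μ, hQ μ, add_zero]
  zero_mem' := fun μ => by simp
  smul_mem' := fun c P hP μ => by
    rw [Matrix.mul_smul, Matrix.smul_mul, Matrix.trace_smul, hP μ, smul_zero]

theorem mem_solutionProfiles_iff {P : Matrix (Fin q) (Fin k ⊕ Fin k) ℂ} :
    P ∈ solutionProfiles A lam u ↔ InitialCondition A lam u P :=
  Iff.rfl

theorem mem_solutionProfiles_iff_systemMap {P : Matrix (Fin q) (Fin k ⊕ Fin k) ℂ}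
    {L : Fin q → Fin p → ℝ} (hL : P * waveMatrix lam u = (Matrix.of L).map Complex.ofReal)
    (x : Fin p → ℝ) : P ∈ solutionProfiles A lam u ↔ systemMap A (x, u, L) = 0 := by
  rw [mem_solutionProfiles_iff, InitialCondition, funext_iff]
  refine forall_congr' fun μ => ?_
  rw [Matrix.mul_assoc, hL, trace_coeffMatrix_mul_map_ofReal μ x, Complex.ofReal_eq_zero]
  rfl

theorem conjProfile_mem_solutionProfiles {P : Matrix (Fin q) (Fin k ⊕ Fin k) ℂ}
    (hP : P ∈ solutionProfiles A lam u) : conjProfile P ∈ solutionProfiles A lam u := by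
  intro μ
  have hreal : (coeffMatrix A μ u).map (starRingEnd ℂ) = coeffMatrix A μ u := by
    ext
    simp [coeffMatrix]
  rw [Matrix.mul_assoc, conjProfile_mul_waveMatrix, ← hreal, ← Matrix.map_mul,
    ← AddMonoidHom.map_trace, ← Matrix.mul_assoc, hP μ, map_zero]

theorem mem_SDelta_inter_SQ_iff {ξ : Fin (p - 2 * k) → (Fin q → ℝ) → (Fin p → ℂ)}
    (hΛ : LinearIndependent ℂ fun s => waveMatrix lam u s) (hξ : IsOrthogonalFrame lam ξ U)
    (hu : u ∈ U) {x : Fin p → ℝ} {L : Fin q → Fin p → ℝ} :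
    (x, u, L) ∈ SDelta A U ∩ SQ ξ ↔ ∃ P ∈ solutionProfiles A lam u,
      P * waveMatrix lam u = (Matrix.of L).map Complex.ofReal := by
  rw [mem_inter_iff, mem_SQ_iff, ← exists_mul_eq_iff_mul_transpose_eq_zero
    (C := frameMatrix ξ u) hΛ (hξ.independent u hu) (card_add_card_of_linearIndependent hΛ)
    (hξ.waveMatrix_mul_transpose hu)]
  constructor
  · rintro ⟨hΔ, P, hP⟩
    exact ⟨P, (mem_solutionProfiles_iff_systemMap hP x).2 hΔ.2, hP⟩
  · rintro ⟨P, hPW, hP⟩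
    exact ⟨⟨hu, (mem_solutionProfiles_iff_systemMap hP x).1 hPW⟩, P, hP⟩

end Profiles

section Stability

variable {p q m k n : ℕ} {A : Fin p → (Fin q → ℝ) → Matrix (Fin m) (Fin q) ℝ}
  {lam : Fin k → (Fin q → ℝ) → (Fin p → ℂ)} {ξ : Fin n → (Fin q → ℝ) → (Fin p → ℂ)}
  {U : Set (Fin q → ℝ)} {u : Fin q → ℝ}

/-- The solution profiles at `u` are stable under the quadratic maps `P ↦ P η_a P`. This is the
algebraic form, at a point, both of the symmetry criterion and of the propagation conditions. -/
def IsStableAt (A : Fin p → (Fin q → ℝ) → Matrix (Fin m) (Fin q) ℝ)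
    (lam : Fin k → (Fin q → ℝ) → (Fin p → ℂ)) (ξ : Fin n → (Fin q → ℝ) → (Fin p → ℂ))
    (u : Fin q → ℝ) : Prop :=
  ∀ P ∈ solutionProfiles A lam u, ∀ a,
    P * etaMatrix lam ξ a u * P ∈ solutionProfiles A lam u

theorem exists_conjProfile_eq_self_decomposition {P : Matrix (Fin q) (Fin k ⊕ Fin k) ℂ}
    (hP : P ∈ solutionProfiles A lam u) :
    ∃ X ∈ solutionProfiles A lam u, ∃ Y ∈ solutionProfiles A lam u,
      conjProfile X = X ∧ conjProfile Y = Y ∧ P = X + Complex.I • Y := by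
  set W := solutionProfiles A lam u
  have hconj := conjProfile_mem_solutionProfiles hP
  refine ⟨(1 / 2 : ℂ) • (P + conjProfile P), W.smul_mem _ (W.add_mem hP hconj),
    (-Complex.I / 2) • (P - conjProfile P), W.smul_mem _ (W.sub_mem hP hconj), ?_, ?_, ?_⟩
  · simp only [conjProfile_smul, conjProfile_add, conjProfile_conjProfile, map_div₀, map_one,
      map_ofNat, add_comm]
  · simp only [conjProfile_smul, conjProfile_sub, conjProfile_conjProfile, map_div₀, map_neg,
      map_ofNat, Complex.conj_I]
    module
  · match_scalars
    · linear_combination (1 / 2 : ℂ) * Complex.I_sq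
    · linear_combination (-1 / 2 : ℂ) * Complex.I_sq

theorem isStableAt_iff_forall_conjProfile_eq_self :
    IsStableAt A lam ξ u ↔ ∀ P ∈ solutionProfiles A lam u, conjProfile P = P →
      ∀ a, P * etaMatrix lam ξ a u * P ∈ solutionProfiles A lam u := by
  refine ⟨fun h P hP _ => h P hP, fun h P hP a => ?_⟩
  obtain ⟨X, hX, Y, hY, hXreal, hYreal, rfl⟩ := exists_conjProfile_eq_self_decomposition hP
  set W := solutionProfiles A lam u
  set η := etaMatrix lam ξ a u
  have hXX : X * η * X ∈ W := h X hX hXreal a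
  have hYY : Y * η * Y ∈ W := h Y hY hYreal a
  have hsum : (X + Y) * η * (X + Y) ∈ W :=
    h _ (W.add_mem hX hY) (by rw [conjProfile_add, hXreal, hYreal]) a
  have hXY : X * η * Y + Y * η * X ∈ W :=
    mul_mul_add_mul_mul_mem (W := W.toAddSubgroup) hXX hYY hsum
  have hexpand : (X + Complex.I • Y) * η * (X + Complex.I • Y)
      = X * η * X - Y * η * Y + Complex.I • (X * η * Y + Y * η * X) := by
    simp only [Matrix.add_mul, Matrix.mul_add, Matrix.smul_mul, Matrix.mul_smul, smul_add,
      smul_smul, Complex.I_mul_I]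
    module
  rw [hexpand]
  exact W.add_mem (W.sub_mem hXX hYY) (W.smul_mem _ hXY)

theorem propagationCondition_iff_symWord_mem {P : Matrix (Fin q) (Fin k ⊕ Fin k) ℂ} {s : ℕ} :
    PropagationCondition A lam ξ u P s ↔ ∀ a : Fin s → Fin n,
      symWord P (fun j => etaMatrix lam ξ (a j) u) ∈ solutionProfiles A lam u := by
  rw [PropagationCondition, forall_comm]
  refine forall_congr' fun a => forall_congr' fun μ => ?_
  simp only [symWord, Matrix.mul_sum, Matrix.sum_mul, Matrix.trace_sum, Matrix.mul_assoc]

theorem propagationCondition_one_iff {P : Matrix (Fin q) (Fin k ⊕ Fin k) ℂ} :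
    PropagationCondition A lam ξ u P 1 ↔
      ∀ a, P * etaMatrix lam ξ a u * P ∈ solutionProfiles A lam u := by
  rw [propagationCondition_iff_symWord_mem,
    ← (Equiv.funUnique (Fin 1) (Fin n)).symm.forall_congr_right]
  simp [symWord]

theorem IsStableAt.propagationCondition (h : IsStableAt A lam ξ u)
    {P : Matrix (Fin q) (Fin k ⊕ Fin k) ℂ} (hP : P ∈ solutionProfiles A lam u) (s : ℕ) :
    PropagationCondition A lam ξ u P s :=
  propagationCondition_iff_symWord_mem.2 fun a => symWord_mem (fun j Q hQ => h Q hQ (a j)) hP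

theorem isStableAt_of_le_one_or_eq_zero (h : q ≤ 1 ∨ k = 0) : IsStableAt A lam ξ u := by
  intro P hP a
  rcases h with hq | rfl
  · have := Fin.subsingleton_iff_le_one.2 hq
    rw [eq_trace_smul_one (P * etaMatrix lam ξ a u), Matrix.smul_mul, Matrix.one_mul]
    exact Submodule.smul_mem _ _ hP
  · rwa [Subsingleton.elim (P * etaMatrix lam ξ a u * P) P]

theorem etaMatrix_eq_sum_smul {n' : ℕ} {ξ' : Fin n' → (Fin q → ℝ) → (Fin p → ℂ)}
    {T : Matrix (Fin n) (Fin n') ℂ} (hT : T * frameMatrix ξ' u = frameMatrix ξ u) (a : Fin n) :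
    etaMatrix lam ξ a u = ∑ b, T a b • etaMatrix lam ξ' b u := by
  have hξ : ∀ i, ξ a u i = ∑ b, T a b * ξ' b u i := fun i => (congrFun (congrFun hT a) i).symm
  ext s β
  simp only [etaMatrix, Matrix.of_apply, Matrix.sum_apply, Matrix.smul_apply, smul_eq_mul, hξ,
    Finset.sum_mul, Finset.mul_sum, mul_assoc]
  exact Finset.sum_comm

theorem IsStableAt.of_frame {ξ' : Fin (p - 2 * k) → (Fin q → ℝ) → (Fin p → ℂ)}
    {U' : Set (Fin q → ℝ)} (h : IsStableAt A lam ξ' u)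
    (hΛ : LinearIndependent ℂ fun s => waveMatrix lam u s) (hξ : IsOrthogonalFrame lam ξ U)
    (hξ' : IsOrthogonalFrame lam ξ' U') (hu : u ∈ U) (hu' : u ∈ U') : IsStableAt A lam ξ u := by
  obtain ⟨T, hT⟩ : ∃ T, T * frameMatrix ξ' u = frameMatrix ξ u := by
    refine (exists_mul_eq_iff_mul_transpose_eq_zero (C := waveMatrix lam u)
      (hξ'.independent u hu') hΛ ?_ (hξ'.frameMatrix_mul_transpose hu')).2
      (hξ.frameMatrix_mul_transpose hu)
    rw [add_comm]
    exact card_add_card_of_linearIndependent hΛ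
  intro P hP a
  rw [etaMatrix_eq_sum_smul hT, Matrix.mul_sum, Matrix.sum_mul]
  refine Submodule.sum_mem _ fun b _ => ?_
  rw [Matrix.mul_smul, Matrix.smul_mul]
  exact Submodule.smul_mem _ _ (h P hP b)

end Stability

section AffineProfile

variable {q k : ℕ}

theorem derivR_star (f : (Fin k → ℂ) → (Fin q → ℂ)) (r : Fin k → ℂ) :
    derivR (fun t => star (f t)) r = conjProfile (derivR f r) := by
  ext α (B | B) <;> simp [derivR, conjProfile, sub_eq_add_neg, map_ofNat]

theorem profileMatrix_eq_derivR_add_conjProfile (f : (Fin k → ℂ) → (Fin q → ℂ))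
    (r : Fin k → ℂ) : profileMatrix f r = derivR f r + conjProfile (derivR f r) := by
  rw [profileMatrix, derivR_star]

theorem derivR_of_hasFDerivAt {f : (Fin k → ℂ) → (Fin q → ℂ)} {r : Fin k → ℂ}
    {M : Matrix (Fin q) (Fin k) ℂ} (hf : HasFDerivAt f M.mulVecLin.toContinuousLinearMap r) :
    derivR f r = Matrix.fromCols M 0 := by
  have hsingle : ∀ B c α, fderiv ℝ f r (Pi.single B c) α = M α B * c := fun B c α => by
    rw [(hf.restrictScalars ℝ).fderiv]
    simp
  ext α (B | B)
  · simp only [derivR, hsingle, Matrix.of_apply, Sum.elim_inl, Matrix.fromCols_apply_inl]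
    linear_combination (-M α B / 2) * Complex.I_sq
  · simp only [derivR, hsingle, Matrix.of_apply, Sum.elim_inr, Matrix.fromCols_apply_inr,
      Matrix.zero_apply]
    linear_combination (M α B / 2) * Complex.I_sq

/-- The affine holomorphic function with the value `u / 2` at `r₀` whose derivative consists of the
first `k` columns of `P`. It realizes a given self-conjugate matrix `P` as a profile matrix. -/
def affineProfile (u : Fin q → ℝ) (P : Matrix (Fin q) (Fin k ⊕ Fin k) ℂ) (r₀ : Fin k → ℂ) :
    (Fin k → ℂ) → (Fin q → ℂ) :=
  fun r => (fun α => (u α : ℂ) / 2) + P.toCols₁ *ᵥ (r - r₀)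

theorem hasFDerivAt_affineProfile (u : Fin q → ℝ) (P : Matrix (Fin q) (Fin k ⊕ Fin k) ℂ)
    (r₀ r : Fin k → ℂ) :
    HasFDerivAt (affineProfile u P r₀) P.toCols₁.mulVecLin.toContinuousLinearMap r :=
  (P.toCols₁.mulVecLin.toContinuousLinearMap.hasFDerivAt.comp r
    ((hasFDerivAt_id r).sub_const r₀)).const_add _

theorem contDiff_affineProfile (u : Fin q → ℝ) (P : Matrix (Fin q) (Fin k ⊕ Fin k) ℂ)
    (r₀ : Fin k → ℂ) : ContDiff ℝ ∞ (affineProfile u P r₀) :=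
  contDiff_const.add ((P.toCols₁.mulVecLin.toContinuousLinearMap.restrictScalars ℝ).contDiff.comp
    (contDiff_id.sub contDiff_const))

theorem affineProfile_self_add_star (u : Fin q → ℝ) (P : Matrix (Fin q) (Fin k ⊕ Fin k) ℂ)
    (r₀ : Fin k → ℂ) (α : Fin q) :
    affineProfile u P r₀ r₀ α + star (affineProfile u P r₀ r₀ α) = u α := by
  simp [affineProfile]

theorem profileMatrix_affineProfile (u : Fin q → ℝ) {P : Matrix (Fin q) (Fin k ⊕ Fin k) ℂ}
    (hP : conjProfile P = P) (r₀ r : Fin k → ℂ) :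
    profileMatrix (affineProfile u P r₀) r = P := by
  rw [profileMatrix_eq_derivR_add_conjProfile,
    derivR_of_hasFDerivAt (hasFDerivAt_affineProfile u P r₀ r)]
  ext α (B | B)
  · simp [conjProfile]
  · rw [← congrFun (congrFun hP α) (Sum.inr B)]
    simp [conjProfile]

end AffineProfile

section Prolongation

variable {p q m k n : ℕ} {A : Fin p → (Fin q → ℝ) → Matrix (Fin m) (Fin q) ℝ}
  {lam : Fin k → (Fin q → ℝ) → (Fin p → ℂ)} {ξ : Fin n → (Fin q → ℝ) → (Fin p → ℂ)}
  {U : Set (Fin q → ℝ)} {u : Fin q → ℝ}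

/-- The Jacobian matrix `∂g/∂u` of a complex vector-valued function `g` of the dependent
variables. -/
def jacobianU (g : (Fin q → ℝ) → (Fin p → ℂ)) (u : Fin q → ℝ) : Matrix (Fin p) (Fin q) ℂ :=
  Matrix.of fun i β => partialU (fun v => g v i) β u

theorem differentiableAt_waveMatrix (hlam : ∀ B, DifferentiableAt ℝ (lam B) u)
    (s : Fin k ⊕ Fin k) (i : Fin p) : DifferentiableAt ℝ (fun v => waveMatrix lam v s i) u := by
  rcases s with B | B
  · exact differentiableAt_pi.1 (hlam B) i
  · exact (differentiableAt_pi.1 (hlam B) i).star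

theorem IsOrthogonalFrame.differentiableAt (hξ : IsOrthogonalFrame lam ξ U) (hU : IsOpen U)
    (hu : u ∈ U) (a : Fin n) : DifferentiableAt ℝ (ξ a) u :=
  ((hξ.smooth a).contDiffAt (hU.mem_nhds hu)).differentiableAt (by simp)

theorem IsOrthogonalFrame.etaMatrix_eq (hξ : IsOrthogonalFrame lam ξ U) (hU : IsOpen U)
    (hlam : ∀ B, DifferentiableAt ℝ (lam B) u) (hu : u ∈ U) (a : Fin n) :
    etaMatrix lam ξ a u = -(waveMatrix lam u * jacobianU (ξ a) u) := by
  ext s β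
  have hderiv : HasFDerivAt (fun v => ∑ i, waveMatrix lam v s i * ξ a v i)
      (∑ i, (waveMatrix lam u s i • fderiv ℝ (fun v => ξ a v i) u
        + ξ a u i • fderiv ℝ (fun v => waveMatrix lam v s i) u)) u :=
    HasFDerivAt.fun_sum fun i _ => (differentiableAt_waveMatrix hlam s i).hasFDerivAt.mul
      (differentiableAt_pi.1 (hξ.differentiableAt hU hu a) i).hasFDerivAt
  have hzero : HasFDerivAt (fun v => ∑ i, waveMatrix lam v s i * ξ a v i)
      (0 : (Fin q → ℝ) →L[ℝ] ℂ) u := by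
    refine (hasFDerivAt_const (0 : ℂ) u).congr_of_eventuallyEq ?_
    filter_upwards [hU.mem_nhds hu] with v hv
    exact congrFun (congrFun (hξ.waveMatrix_mul_transpose hv) s) a
  have hsum : (waveMatrix lam u * jacobianU (ξ a) u) s β + etaMatrix lam ξ a u s β = 0 := by
    simpa [Finset.sum_add_distrib, Matrix.mul_apply, jacobianU, etaMatrix, partialU]
      using DFunLike.congr_fun (hderiv.unique hzero) (Pi.single β 1)
  exact eq_neg_of_add_eq_zero_right hsum

theorem differentiableAt_systemMap {z : Jet p q}
    (hA : ∀ i μ α, DifferentiableAt ℝ (fun u => A i u μ α) z.2.1) (μ : Fin m) :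
    DifferentiableAt ℝ (fun w : Jet p q => systemMap A w μ) z := by
  refine DifferentiableAt.fun_sum fun i _ => DifferentiableAt.fun_sum fun α _ => ?_
  exact ((hA i μ α).comp z (f := fun w : Jet p q => w.2.1) (by fun_prop)).mul (by fun_prop)

theorem fderiv_systemMap {x : Fin p → ℝ} {L : Fin q → Fin p → ℝ}
    (hA : ∀ i μ α, DifferentiableAt ℝ (fun u => A i u μ α) u) (μ : Fin m)
    (v : Fin p → ℝ) (K : Fin q → Fin p → ℝ) :
    fderiv ℝ (fun w : Jet p q => systemMap A w μ) (x, u, L) (v, 0, K)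
      = systemMap A (x, u, K) μ := by
  have hline : (fun t : ℝ => systemMap A ((x, u, L) + t • (v, 0, K)) μ)
      = fun t => systemMap A (x, u, L) μ + t * systemMap A (x, u, K) μ := by
    funext t
    simp [systemMap, mul_add, Finset.sum_add_distrib, Finset.mul_sum, mul_left_comm]
  rw [← (differentiableAt_systemMap hA μ).lineDeriv_eq_fderiv, lineDeriv, hline]
  simp

theorem systemMap_single (x : Fin p → ℝ) (μ : Fin m) (α : Fin q) (j : Fin p) :
    systemMap A (x, u, Pi.single α (Pi.single j 1)) μ = A j u μ α := by
  simp [systemMap, Pi.single_apply, ite_apply]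

theorem prolongation_systemMap {x : Fin p → ℝ} {L : Fin q → Fin p → ℝ}
    (hA : ∀ i μ α, DifferentiableAt ℝ (fun u => A i u μ α) u) (a : Fin n) (μ : Fin m) :
    prolongation ξ a (fun w => systemMap A w μ) (x, u, L)
      = -(coeffMatrix A μ u * ((Matrix.of L).map Complex.ofReal * jacobianU (ξ a) u
        * (Matrix.of L).map Complex.ofReal)).trace := by
  have hbase : ∀ v, systemMap A (x, u, (0 : Fin q → Fin p → ℝ)) v = 0 := fun v => by
    simp [systemMap]
  simp only [prolongation, fderiv_systemMap hA, systemMap_single, hbase, Complex.ofReal_zero,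
    mul_zero, Finset.sum_const_zero, zero_sub]
  simp only [Matrix.trace, Matrix.diag_apply, Matrix.mul_apply, coeffMatrix, jacobianU,
    Matrix.of_apply, Matrix.map_apply]
  rw [Finset.sum_comm]
  simp only [Finset.mul_sum, Finset.sum_mul]
  refine congrArg Neg.neg (Finset.sum_congr rfl fun j _ => Finset.sum_congr rfl fun α _ => ?_)
  rw [Finset.sum_comm]
  exact Finset.sum_congr rfl fun β _ => Finset.sum_congr rfl fun i _ => by ring

theorem prolongation_systemMap_of_mul_waveMatrix_eq (hU : IsOpen U)
    (hA : ∀ i μ α, DifferentiableAt ℝ (fun u => A i u μ α) u)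
    (hlam : ∀ B, DifferentiableAt ℝ (lam B) u) (hξ : IsOrthogonalFrame lam ξ U) (hu : u ∈ U)
    {x : Fin p → ℝ} {L : Fin q → Fin p → ℝ} {P : Matrix (Fin q) (Fin k ⊕ Fin k) ℂ}
    (hL : P * waveMatrix lam u = (Matrix.of L).map Complex.ofReal) (a : Fin n) (μ : Fin m) :
    prolongation ξ a (fun w => systemMap A w μ) (x, u, L)
      = (coeffMatrix A μ u * (P * etaMatrix lam ξ a u * P) * waveMatrix lam u).trace := by
  rw [prolongation_systemMap hA, hξ.etaMatrix_eq hU hlam hu, ← hL]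
  simp only [Matrix.mul_neg, Matrix.neg_mul, Matrix.trace_neg, Matrix.mul_assoc]

theorem fderiv_comp_snd_apply {E F G : Type*} [NormedAddCommGroup E] [NormedSpace ℝ E]
    [NormedAddCommGroup F] [NormedSpace ℝ F] [NormedAddCommGroup G] [NormedSpace ℝ G]
    {g : F → G} {y : E × F} (hg : DifferentiableAt ℝ g y.2) (v : E) :
    fderiv ℝ (fun t : E × F => g t.2) y (v, 0) = 0 := by
  have hcomp : HasFDerivAt (fun t : E × F => g t.2)
      ((fderiv ℝ g y.2).comp (ContinuousLinearMap.snd ℝ E F)) y :=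
    hg.hasFDerivAt.comp y hasFDerivAt_snd
  rw [hcomp.fderiv]
  simp

theorem bracket_fieldX {y : (Fin p → ℝ) × (Fin q → ℝ)}
    (hξ : ∀ a, DifferentiableAt ℝ (ξ a) y.2) (a b : Fin n) :
    bracket (fieldX ξ a) (fieldX ξ b) y = 0 := by
  have hconst : ∀ c i v,
      fderiv ℝ (fun t : (Fin p → ℝ) × (Fin q → ℝ) => ξ c t.2 i) y (v, 0) = 0 := fun c i =>
    fderiv_comp_snd_apply (g := fun t => ξ c t i) (differentiableAt_pi.1 (hξ c) i)
  ext i <;> simp [bracket, applyField, fieldX, hconst]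

theorem linearIndependent_fieldX {N : Set ((Fin p → ℝ) × (Fin q → ℝ))} {y : N}
    (hξ : LinearIndependent ℂ fun a => ξ a y.1.2) :
    LinearIndependent ℂ fun (a : Fin n) (y : N) => fieldX ξ a y :=
  LinearIndependent.of_comp ((LinearMap.fst ℂ (Fin p → ℂ) (Fin q → ℂ)).comp (LinearMap.proj y)) hξ

end Prolongation

section Symmetry

variable {p q m k : ℕ} {A : Fin p → (Fin q → ℝ) → Matrix (Fin m) (Fin q) ℝ}
  {lam : Fin k → (Fin q → ℝ) → (Fin p → ℂ)} {ξ : Fin (p - 2 * k) → (Fin q → ℝ) → (Fin p → ℂ)}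
  {U : Set (Fin q → ℝ)} {u : Fin q → ℝ}

theorem isStableAt_iff_prolongation (hU : IsOpen U)
    (hA : ∀ i μ α, DifferentiableAt ℝ (fun u => A i u μ α) u)
    (hlam : ∀ B, DifferentiableAt ℝ (lam B) u)
    (hΛ : LinearIndependent ℂ fun s => waveMatrix lam u s)
    (hξ : IsOrthogonalFrame lam ξ U) (hu : u ∈ U) (x : Fin p → ℝ) :
    IsStableAt A lam ξ u ↔ ∀ L : Fin q → Fin p → ℝ, (x, u, L) ∈ SDelta A U ∩ SQ ξ →
      ∀ a μ, prolongation ξ a (fun w => systemMap A w μ) (x, u, L) = 0 := by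
  constructor
  · intro h L hL a μ
    obtain ⟨P, hP, hPL⟩ := (mem_SDelta_inter_SQ_iff hΛ hξ hu).1 hL
    rw [prolongation_systemMap_of_mul_waveMatrix_eq hU hA hlam hξ hu hPL]
    exact h P hP a μ
  · refine fun h => isStableAt_iff_forall_conjProfile_eq_self.2 fun P hP hreal a μ => ?_
    obtain ⟨L, hPL⟩ := (conjProfile_eq_self_iff hΛ).1 hreal
    rw [← prolongation_systemMap_of_mul_waveMatrix_eq hU hA hlam hξ hu (x := x) hPL]
    exact h L ((mem_SDelta_inter_SQ_iff hΛ hξ hu).2 ⟨P, hP, hPL⟩) a μ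

theorem isStableAt_iff_trace {M : ℕ} (hM : q ≤ 1 ∨ k = 0 ∨ 2 ≤ M)
    (hΛ : LinearIndependent ℂ fun s => waveMatrix lam u s)
    (hξ : IsOrthogonalFrame lam ξ U) (hu : u ∈ U) (x : Fin p → ℝ) :
    IsStableAt A lam ξ u ↔ ∀ L : Fin q → Fin p → ℝ, (x, u, L) ∈ SDelta A U ∩ SQ ξ →
      ∀ f : (Fin k → ℂ) → (Fin q → ℂ),
        ContDiffAt ℝ ∞ f (riemannInvariant lam x u) →
        (∀ α, (u α : ℂ) = f (riemannInvariant lam x u) α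
          + star (f (riemannInvariant lam x u) α)) →
        profileMatrix f (riemannInvariant lam x u) * waveMatrix lam u
          = Matrix.of (fun α i => (L α i : ℂ)) →
        InitialCondition A lam u (profileMatrix f (riemannInvariant lam x u)) ∧
        ∀ s, 1 ≤ s → s < M → PropagationCondition A lam ξ u
          (profileMatrix f (riemannInvariant lam x u)) s := by
  constructor
  · rintro h L ⟨hL, -⟩ f - - hfL
    have hf := (mem_solutionProfiles_iff_systemMap hfL x).2 hL.2
    exact ⟨hf, fun s _ _ => h.propagationCondition hf s⟩
  · intro h
    rcases or_assoc.2 hM with hsmall | hM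
    · exact isStableAt_of_le_one_or_eq_zero hsmall
    refine isStableAt_iff_forall_conjProfile_eq_self.2 fun P hP hreal => ?_
    obtain ⟨L, hPL⟩ := (conjProfile_eq_self_iff hΛ).1 hreal
    set r := riemannInvariant lam x u
    have hprofile : profileMatrix (affineProfile u P r) r = P :=
      profileMatrix_affineProfile u hreal r r
    have htrace := (h L ((mem_SDelta_inter_SQ_iff hΛ hξ hu).2 ⟨P, hP, hPL⟩)
      (affineProfile u P r) (contDiff_affineProfile u P r).contDiffAt
      (fun α => (affineProfile_self_add_star u P r α).symm) (by rw [hprofile]; exact hPL)).2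
      1 le_rfl hM
    rwa [hprofile, propagationCondition_one_iff] at htrace

theorem generatesSymmetryAlgebraNear_iff (hU : IsOpen U)
    (hA : ∀ i μ α, DifferentiableOn ℝ (fun u => A i u μ α) U)
    (hlam : ∀ B, DifferentiableOn ℝ (lam B) U)
    (hΛ : ∀ u ∈ U, LinearIndependent ℂ fun s => waveMatrix lam u s)
    (hξ : IsOrthogonalFrame lam ξ U) (y₀ : (Fin p → ℝ) × (Fin q → ℝ)) :
    GeneratesSymmetryAlgebraNear A U ξ y₀ ↔
      ∃ N ∈ 𝓝 y₀, N ⊆ univ ×ˢ U ∧ ∀ y ∈ N, IsStableAt A lam ξ y.2 := by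
  refine exists_congr fun N => and_congr_right fun hN => and_congr_right fun hNU => ?_
  have hstable := fun y (hy : y ∈ N) => isStableAt_iff_prolongation hU
    (fun i μ α => (hA i μ α).differentiableAt (hU.mem_nhds (hNU hy).2))
    (fun B => (hlam B).differentiableAt (hU.mem_nhds (hNU hy).2)) (hΛ y.2 (hNU hy).2) hξ
    (hNU hy).2 y.1
  constructor
  · exact fun h y hy => (hstable y hy).2 fun L hL => h.symmetric (y.1, y.2, L) hL hy
  · intro h
    have hy₀ : y₀ ∈ N := mem_of_mem_nhds hN
    refine ⟨linearIndependent_fieldX (y := ⟨y₀, hy₀⟩) (hξ.independent y₀.2 (hNU hy₀).2),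
      fun a b y hy => bracket_fieldX (hξ.differentiableAt hU (hNU hy).2) a b, ?_⟩
    rintro ⟨x, u, L⟩ hL hy
    exact (hstable (x, u) hy).1 (h _ hy) L hL

theorem traceConditionsNear_iff {M : ℕ} (hM : q ≤ 1 ∨ k = 0 ∨ 2 ≤ M)
    (hΛ : ∀ u ∈ U, LinearIndependent ℂ fun s => waveMatrix lam u s)
    (hξ : IsOrthogonalFrame lam ξ U) (y₀ : (Fin p → ℝ) × (Fin q → ℝ)) :
    TraceConditionsNear M A lam U ξ y₀ ↔
      ∃ N ∈ 𝓝 y₀, N ⊆ univ ×ˢ U ∧ ∀ y ∈ N, IsStableAt A lam ξ y.2 := by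
  refine exists_congr fun N => and_congr_right fun _ => and_congr_right fun hNU => ?_
  have hstable := fun y (hy : y ∈ N) =>
    isStableAt_iff_trace (A := A) hM (hΛ y.2 (hNU hy).2) hξ (hNU hy).2 y.1
  constructor
  · exact fun h y hy => (hstable y hy).2 fun L hL => h (y.1, y.2, L) hL hy
  · rintro h ⟨x, u, L⟩ hL hy
    exact (hstable (x, u) hy).1 (h _ hy) L hL

theorem admitsSymmetryAlgebraNear_iff (hU : IsOpen U)
    (hA : ∀ i μ α, DifferentiableOn ℝ (fun u => A i u μ α) U)
    (hlam : ∀ B, DifferentiableOn ℝ (lam B) U)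
    (hΛ : ∀ u ∈ U, LinearIndependent ℂ fun s => waveMatrix lam u s)
    (hξ : IsOrthogonalFrame lam ξ U) (y₀ : (Fin p → ℝ) × (Fin q → ℝ)) :
    AdmitsSymmetryAlgebraNear A lam U y₀ ↔ GeneratesSymmetryAlgebraNear A U ξ y₀ := by
  constructor
  · rintro ⟨U', ξ', hU', -, hU'U, hξ', h⟩
    obtain ⟨N, hN, hNU', hstable⟩ := (generatesSymmetryAlgebraNear_iff hU'
      (fun i μ α => (hA i μ α).mono hU'U) (fun B => (hlam B).mono hU'U)
      (fun u hu => hΛ u (hU'U hu)) hξ' y₀).1 h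
    have hNU : N ⊆ univ ×ˢ U := hNU'.trans (prod_mono_right hU'U)
    exact (generatesSymmetryAlgebraNear_iff hU hA hlam hΛ hξ y₀).2 ⟨N, hN, hNU, fun y hy =>
      (hstable y hy).of_frame (hΛ _ (hNU hy).2) hξ hξ' (hNU hy).2 (hNU' hy).2⟩
  · rintro ⟨N, hN, hNU, h⟩
    exact ⟨U, ξ, hU, (hNU (mem_of_mem_nhds hN)).2, Subset.rfl, hξ, N, hN, hNU, h⟩

end Symmetry

section Submersions

variable {E F G K : Type*} [NormedAddCommGroup E] [NormedSpace ℝ E]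
  [NormedAddCommGroup F] [NormedSpace ℝ F] [NormedAddCommGroup G] [NormedSpace ℝ G]
  [NormedAddCommGroup K] [NormedSpace ℝ K]

theorem eventually_surjective [FiniteDimensional ℝ F] {T : E →L[ℝ] F}
    (hT : Function.Surjective T) : ∀ᶠ S : E →L[ℝ] F in 𝓝 T, Function.Surjective S := by
  have : CompleteSpace F := FiniteDimensional.complete ℝ F
  obtain ⟨s, hs⟩ := T.exists_rightInverse_of_surjective (LinearMap.range_eq_top.2 hT)
  have hTs : IsUnit (T.comp s) := hs.symm ▸ isUnit_one
  have hcont : Continuous fun S : E →L[ℝ] F => S.comp s := by fun_prop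
  have hunit : ∀ᶠ S : E →L[ℝ] F in 𝓝 T, IsUnit (S.comp s) :=
    hcont.continuousAt.eventually (Units.isOpen.mem_nhds hTs)
  filter_upwards [hunit] with S hS
  exact Function.Surjective.of_comp (g := s)
    (ContinuousLinearEquiv.unitsEquiv ℝ F hS.unit).surjective

theorem eventually_differentiableAt {f : E → F} {x : E} (hf : ContDiffAt ℝ 1 f x) :
    ∀ᶠ y in 𝓝 x, DifferentiableAt ℝ f y :=
  (hf.eventually (by simp)).mono fun _ hy => hy.differentiableAt one_ne_zero

theorem eventually_eq_of_fderiv_prodMk_zero {f : F × K → G} {y₀ : F × K}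
    (hf : ∀ᶠ y in 𝓝 y₀, DifferentiableAt ℝ f y)
    (hf' : ∀ᶠ y in 𝓝 y₀, ∀ κ, fderiv ℝ f y (0, κ) = 0) :
    ∀ᶠ y in 𝓝 y₀, f y = f (y.1, y₀.2) := by
  obtain ⟨ε, hε, hball⟩ := Metric.eventually_nhds_iff_ball.1 (hf.and hf')
  filter_upwards [Metric.ball_mem_nhds y₀ hε] with y hy
  rw [← ball_prod_same] at hball hy
  have hslice (κ) (hκ : κ ∈ Metric.ball y₀.2 ε) :
      HasFDerivAt (fun κ => f (y.1, κ)) (0 : K →L[ℝ] G) κ := by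
    obtain ⟨hd, hzero⟩ := hball (y.1, κ) ⟨hy.1, hκ⟩
    exact (hd.hasFDerivAt.comp κ (hasFDerivAt_prodMk_right y.1 κ)).congr_fderiv
      (ContinuousLinearMap.ext hzero)
  exact Metric.isOpen_ball.is_const_of_fderiv_eq_zero (𝕜 := ℝ)
    (convex_ball y₀.2 ε).isPreconnected
    (fun κ hκ => (hslice κ hκ).differentiableAt.differentiableWithinAt)
    (fun κ hκ => (hslice κ hκ).fderiv) hy.2 (Metric.mem_ball_self hε)

variable [CompleteSpace E] [FiniteDimensional ℝ F] {n : ℕ∞ω} {r : E → F} {u : E → G} {x₀ : E}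

theorem exists_local_trivialization (hr : ContDiffAt ℝ n r x₀) (hn : n ≠ 0)
    (hsurj : Function.Surjective (fderiv ℝ r x₀)) :
    ∃ (π : E → (fderiv ℝ r x₀).ker) (ψ : F × (fderiv ℝ r x₀).ker → E),
      ContinuousAt π x₀ ∧ ContDiffAt ℝ n ψ (r x₀, π x₀) ∧
        (∀ᶠ y in 𝓝 (r x₀, π x₀), r (ψ y) = y.1) ∧ ∀ᶠ x in 𝓝 x₀, ψ (r x, π x) = x := by
  have : CompleteSpace F := FiniteDimensional.complete ℝ F
  let φ := HasStrictFDerivAt.implicitFunctionDataOfComplemented r (fderiv ℝ r x₀)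
    (hr.hasStrictFDerivAt hn) (LinearMap.range_eq_top.2 hsurj)
    (ContinuousLinearMap.ker_closedComplemented_of_finiteDimensional_range _)
  have hπ : ContDiff ℝ n φ.rightFun :=
    (ContinuousLinearMap.contDiff _).comp (contDiff_id.sub contDiff_const)
  exact ⟨φ.rightFun, φ.implicitFunction.uncurry, hπ.continuous.continuousAt,
    φ.contDiffAt_implicitFunction hr hπ.contDiffAt hn,
    φ.leftFun_implicitFunction, φ.implicitFunction_apply_image⟩

theorem contDiffAt_of_eventually_eq_comp (hn : n ≠ 0) (hr : ContDiffAt ℝ n r x₀)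
    (hsurj : Function.Surjective (fderiv ℝ r x₀)) (hu : ContDiffAt ℝ n u x₀) {g : F → G}
    (hug : ∀ᶠ x in 𝓝 x₀, u x = g (r x)) : ContDiffAt ℝ n g (r x₀) := by
  obtain ⟨π, ψ, -, hψ, hrψ, hψr⟩ := exists_local_trivialization hr hn hsurj
  have hψ₀ : ψ (r x₀, π x₀) = x₀ := hψr.self_of_nhds
  have hsection : ContDiffAt ℝ n (fun c => ψ (c, π x₀)) (r x₀) :=
    hψ.comp (r x₀) (contDiffAt_id.prodMk contDiffAt_const)
  have hcont : ContinuousAt (fun c => (c, π x₀)) (r x₀) := by fun_prop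
  have hug' : ∀ᶠ c in 𝓝 (r x₀), g c = u (ψ (c, π x₀)) := by
    filter_upwards [hcont.eventually hrψ,
      hsection.continuousAt.eventually (hψ₀.symm ▸ hug)] with c hc hc'
    rw [hc', hc]
  exact (ContDiffAt.comp (r x₀) (hψ₀.symm ▸ hu) hsection).congr_of_eventuallyEq hug'

theorem exists_eventually_eq_comp_of_ker_fderiv_le (hr : ContDiffAt ℝ 1 r x₀)
    (hsurj : Function.Surjective (fderiv ℝ r x₀)) (hu : ∀ᶠ x in 𝓝 x₀, DifferentiableAt ℝ u x)
    (hker : ∀ᶠ x in 𝓝 x₀, (fderiv ℝ r x).ker ≤ (fderiv ℝ u x).ker) :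
    ∃ g : F → G, ∀ᶠ x in 𝓝 x₀, u x = g (r x) := by
  obtain ⟨π, ψ, hπ, hψ, hrψ, hψr⟩ := exists_local_trivialization hr one_ne_zero hsurj
  have hψ₀ : ψ (r x₀, π x₀) = x₀ := hψr.self_of_nhds
  have htendsto : Filter.Tendsto ψ (𝓝 (r x₀, π x₀)) (𝓝 x₀) := by
    simpa only [hψ₀] using hψ.continuousAt.tendsto
  have hψd : ∀ᶠ y in 𝓝 (r x₀, π x₀), DifferentiableAt ℝ ψ y :=
    eventually_differentiableAt hψ
  have hrd : ∀ᶠ x in 𝓝 x₀, DifferentiableAt ℝ r x :=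
    eventually_differentiableAt hr
  have hconst : ∀ᶠ y in 𝓝 (r x₀, π x₀), u (ψ y) = u (ψ (y.1, π x₀)) := by
    refine eventually_eq_of_fderiv_prodMk_zero (f := u ∘ ψ) ?_ ?_
    · filter_upwards [hψd, htendsto.eventually hu] with y hψy huy using huy.comp y hψy
    · filter_upwards [hψd, htendsto.eventually hu, htendsto.eventually hrd,
        htendsto.eventually hker, hrψ.eventually_nhds] with y hψy huy hry hkery hrψy κ
      have hvertical : fderiv ℝ r (ψ y) (fderiv ℝ ψ y (0, κ)) = 0 := by
        have hfst : HasFDerivAt (r ∘ ψ) (ContinuousLinearMap.fst ℝ F _) y :=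
          hasFDerivAt_fst.congr_of_eventuallyEq hrψy
        exact DFunLike.congr_fun ((hry.hasFDerivAt.comp y hψy.hasFDerivAt).unique hfst) (0, κ)
      rw [fderiv_comp y huy hψy]
      exact hkery hvertical
  refine ⟨fun c => u (ψ (c, π x₀)), ?_⟩
  filter_upwards [(hr.continuousAt.prodMk hπ).eventually hconst, hψr] with x hx hψx
  rwa [hψx] at hx

theorem exists_contDiffOn_comp_of_ker_fderiv_le (hn : n ≠ 0)
    (hr : ∀ᶠ x in 𝓝 x₀, ContDiffAt ℝ n r x) (hu : ∀ᶠ x in 𝓝 x₀, ContDiffAt ℝ n u x)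
    (hsurj : Function.Surjective (fderiv ℝ r x₀))
    (hker : ∀ᶠ x in 𝓝 x₀, (fderiv ℝ r x).ker ≤ (fderiv ℝ u x).ker) :
    ∃ (O : Set F) (g : F → G), IsOpen O ∧ ContDiffOn ℝ n g O ∧
      ∀ᶠ x in 𝓝 x₀, r x ∈ O ∧ u x = g (r x) := by
  have : CompleteSpace F := FiniteDimensional.complete ℝ F
  have hr₀ : ContDiffAt ℝ 1 r x₀ := hr.self_of_nhds.of_le (ENat.one_le_iff_ne_zero_withTop.2 hn)
  obtain ⟨g, hug⟩ := exists_eventually_eq_comp_of_ker_fderiv_le hr₀ hsurj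
    (hu.mono fun x hx => hx.differentiableAt hn) hker
  have hsurj' : ∀ᶠ x in 𝓝 x₀, Function.Surjective (fderiv ℝ r x) :=
    (hr₀.continuousAt_fderiv one_ne_zero).eventually (eventually_surjective hsurj)
  have hg : ∀ᶠ x in 𝓝 x₀, ContDiffAt ℝ n g (r x) := by
    filter_upwards [hr, hsurj', hu, hug.eventually_nhds] with x hrx hsx hux hugx
      using contDiffAt_of_eventually_eq_comp hn hrx hsx hux hugx
  have hg' : ∀ᶠ c in 𝓝 (r x₀), ContDiffAt ℝ n g c := by
    rw [← (hr₀.hasStrictFDerivAt one_ne_zero).map_nhds_eq_of_surj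
      (LinearMap.range_eq_top.2 hsurj)]
    exact hg
  refine ⟨interior {c | ContDiffAt ℝ n g c}, g, isOpen_interior,
    fun c hc => (interior_subset hc).contDiffWithinAt, ?_⟩
  filter_upwards [hr₀.continuousAt.eventually (interior_mem_nhds.2 hg'), hug] with x hx hugx
    using ⟨hx, hugx⟩

end Submersions

section SelfComposition

theorem ker_eq_of_le_of_surjective {K V W : Type*} [DivisionRing K] [AddCommGroup V] [Module K V]
    [FiniteDimensional K V] [AddCommGroup W] [Module K W] {S T : V →ₗ[K] W}
    (hS : Function.Surjective S) (hT : Function.Surjective T) (hle : S.ker ≤ T.ker) :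
    S.ker = T.ker := by
  have hrankS := S.finrank_range_add_finrank_ker
  have hrankT := T.finrank_range_add_finrank_ker
  rw [LinearMap.range_eq_top.2 hS] at hrankS
  rw [LinearMap.range_eq_top.2 hT] at hrankT
  exact Submodule.eq_of_le_of_finrank_eq hle (by omega)

theorem eq_zero_of_apply_eq_self_of_norm_lt_one {G : Type*} [NormedAddCommGroup G]
    [NormedSpace ℝ G] {T : G →L[ℝ] G} (hT : ‖T‖ < 1) {w : G} (hw : T w = w) : w = 0 := by
  by_contra hne
  exact (T.le_opNorm w).not_gt <| by
    rw [hw]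
    exact mul_lt_of_lt_one_left (norm_pos_iff.2 hne) hT

variable {E F G : Type*} [NormedAddCommGroup E] [NormedSpace ℝ E]
  [NormedAddCommGroup F] [NormedSpace ℝ F] [NormedAddCommGroup G] [NormedSpace ℝ G]
  {Λ : G → E →L[ℝ] F} {u : E → G} {n : ℕ∞ω}

theorem hasFDerivAt_clm_apply_self {x : E} (hΛ : DifferentiableAt ℝ Λ (u x))
    (hu : DifferentiableAt ℝ u x) :
    HasFDerivAt (fun x => Λ (u x) x)
      (Λ (u x) + ((fderiv ℝ Λ (u x)).flip x).comp (fderiv ℝ u x)) x :=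
  (hΛ.hasFDerivAt.comp x hu.hasFDerivAt).clm_apply (hasFDerivAt_id x)

theorem exists_contDiffOn_comp_of_ker_le [FiniteDimensional ℝ E] [FiniteDimensional ℝ F]
    (hn : n ≠ 0) (hΛ : ∀ᶠ v in 𝓝 (u 0), ContDiffAt ℝ n Λ v)
    (hu : ∀ᶠ x in 𝓝 0, ContDiffAt ℝ n u x) (hsurj : Function.Surjective (Λ (u 0)))
    (hker : ∀ᶠ x in 𝓝 0, (Λ (u x)).ker ≤ (fderiv ℝ u x).ker) :
    ∃ (O : Set F) (g : F → G), IsOpen O ∧ ContDiffOn ℝ n g O ∧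
      ∀ᶠ x in 𝓝 0, Λ (u x) x ∈ O ∧ u x = g (Λ (u x) x) := by
  have : CompleteSpace E := FiniteDimensional.complete ℝ E
  set r : E → F := fun x => Λ (u x) x
  have hcont : ContinuousAt u 0 := hu.self_of_nhds.continuousAt
  have hΛu : ∀ᶠ x in 𝓝 0, ContDiffAt ℝ n Λ (u x) := hcont.eventually hΛ
  have hrn : ∀ᶠ x in 𝓝 0, ContDiffAt ℝ n r x := by
    filter_upwards [hΛu, hu] with x hΛx hux using (hΛx.comp x hux).clm_apply contDiffAt_id
  have hfderiv : ∀ᶠ x in 𝓝 0,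
      fderiv ℝ r x = Λ (u x) + ((fderiv ℝ Λ (u x)).flip x).comp (fderiv ℝ u x) := by
    filter_upwards [hΛu, hu] with x hΛx hux using
      (hasFDerivAt_clm_apply_self (hΛx.differentiableAt hn) (hux.differentiableAt hn)).fderiv
  have hrsurj : Function.Surjective (fderiv ℝ r 0) := by
    rw [hfderiv.self_of_nhds]
    simpa using hsurj
  have hrsurj' : ∀ᶠ x in 𝓝 0, Function.Surjective (fderiv ℝ r x) :=
    (hrn.self_of_nhds.continuousAt_fderiv hn).eventually (eventually_surjective hrsurj)
  have hΛsurj : ∀ᶠ x in 𝓝 0, Function.Surjective (Λ (u x)) :=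
    (hΛ.self_of_nhds.continuousAt.comp hcont).eventually (eventually_surjective hsurj)
  refine exists_contDiffOn_comp_of_ker_fderiv_le hn hrn hu hrsurj ?_
  filter_upwards [hfderiv, hrsurj', hΛsurj, hker] with x hx hrx hΛx hkerx
  have hle : (Λ (u x)).ker ≤ (fderiv ℝ r x).ker := fun w hw => by
    have hΛw : Λ (u x) w = 0 := hw
    have huw : fderiv ℝ u x w = 0 := hkerx hw
    simp [hx, hΛw, huw]
  rwa [← ker_eq_of_le_of_surjective hΛx hrx hle]

theorem eventually_ker_le_of_eventually_eq_comp {g : F → G} (hΛ : ContDiffAt ℝ 1 Λ (u 0))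
    (hu : ContDiffAt ℝ 1 u 0) (hg : ContDiffAt ℝ 1 g 0)
    (hug : ∀ᶠ x in 𝓝 0, u x = g (Λ (u x) x)) :
    ∀ᶠ x in 𝓝 0, (Λ (u x)).ker ≤ (fderiv ℝ u x).ker := by
  set r : E → F := fun x => Λ (u x) x
  have hr₀ : r 0 = 0 := map_zero _
  have hrc : ContinuousAt r 0 := ((hΛ.comp 0 hu).clm_apply contDiffAt_id).continuousAt
  have htendsto : Filter.Tendsto r (𝓝 0) (𝓝 0) := by simpa only [hr₀] using hrc.tendsto
  set T : E → G →L[ℝ] G := fun x => (fderiv ℝ g (r x)).comp ((fderiv ℝ Λ (u x)).flip x)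
  have hsmall : ∀ᶠ x in 𝓝 0, ‖T x‖ < 1 := by
    have hΛ' : ContinuousAt (fun x => fderiv ℝ Λ (u x)) 0 :=
      (hΛ.continuousAt_fderiv one_ne_zero).comp hu.continuousAt
    have hg' : ContinuousAt (fun x => fderiv ℝ g (r x)) 0 :=
      (hr₀.symm ▸ hg.continuousAt_fderiv one_ne_zero).comp hrc
    have hflip : ContinuousAt (fun x => (fderiv ℝ Λ (u x)).flip) 0 :=
      (ContinuousLinearMap.flipₗᵢ ℝ G E F).continuous.continuousAt.comp hΛ'
    have hT : ContinuousAt T 0 := hg'.clm_comp (hflip.clm_apply continuousAt_id)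
    refine hT.norm.eventually_lt continuousAt_const ?_
    simp [T]
  have hΛd : ∀ᶠ x in 𝓝 0, DifferentiableAt ℝ Λ (u x) :=
    hu.continuousAt.eventually (eventually_differentiableAt hΛ)
  have hgd : ∀ᶠ x in 𝓝 0, DifferentiableAt ℝ g (r x) :=
    htendsto.eventually (eventually_differentiableAt hg)
  filter_upwards [hsmall, hΛd, eventually_differentiableAt hu, hgd, hug.eventually_nhds]
    with x hTx hΛx hux hgx hugx w hw
  have hderiv : HasFDerivAt u _ x :=
    (hgx.hasFDerivAt.comp x (hasFDerivAt_clm_apply_self hΛx hux)).congr_of_eventuallyEq hugx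
  have hΛw : Λ (u x) w = 0 := hw
  refine eq_zero_of_apply_eq_self_of_norm_lt_one hTx ?_
  simpa [T, hΛw] using (DFunLike.congr_fun hderiv.fderiv w).symm

end SelfComposition

section Modes

variable {p q k : ℕ} {lam : Fin k → (Fin q → ℝ) → (Fin p → ℂ)}
  {ξ : Fin (p - 2 * k) → (Fin q → ℝ) → (Fin p → ℂ)} {U : Set (Fin q → ℝ)} {v : Fin q → ℝ}

/-- The real-linear map `x ↦ r(x, v)`, which encodes the wave vectors at `v` by its kernel, the
space of the real vectors orthogonal to them. -/
def waveCLM (lam : Fin k → (Fin q → ℝ) → (Fin p → ℂ)) (v : Fin q → ℝ) :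
    (Fin p → ℝ) →L[ℝ] (Fin k → ℂ) :=
  ContinuousLinearMap.pi fun B => ∑ i, lam B v i •
    (Complex.ofRealCLM.comp (ContinuousLinearMap.proj i : (Fin p → ℝ) →L[ℝ] ℝ))

theorem waveCLM_apply (x : Fin p → ℝ) : waveCLM lam v x = riemannInvariant lam x v := by
  ext B
  simp [waveCLM, riemannInvariant]

theorem contDiffOn_waveCLM {n : ℕ∞ω} (hlam : ∀ B, ContDiffOn ℝ n (lam B) U) :
    ContDiffOn ℝ n (waveCLM lam) U := by
  refine contDiffOn_clm_apply.2 fun x => contDiffOn_pi.2 fun B => ?_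
  simp only [waveCLM_apply, riemannInvariant]
  exact ContDiffOn.sum fun i _ => (contDiffOn_pi.1 (hlam B) i).mul contDiffOn_const

theorem waveMatrix_mulVec (w : Fin p → ℂ) :
    waveMatrix lam v *ᵥ w =
      Sum.elim
        (fun B => waveCLM lam v (fun i => (w i).re) B
          + Complex.I * waveCLM lam v (fun i => (w i).im) B)
        (fun B => star (waveCLM lam v (fun i => (w i).re) B
          - Complex.I * waveCLM lam v (fun i => (w i).im) B)) := by
  ext (B | B)
  · simp only [Matrix.mulVec, dotProduct, waveCLM_apply, riemannInvariant, Sum.elim_inl,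
      Finset.mul_sum, ← Finset.sum_add_distrib]
    refine Finset.sum_congr rfl fun i _ => ?_
    conv_lhs => rw [← Complex.re_add_im (w i)]
    simp only [waveMatrix, Matrix.of_apply, Sum.elim_inl]
    ring
  · simp only [Matrix.mulVec, dotProduct, waveCLM_apply, riemannInvariant, Sum.elim_inr,
      Finset.mul_sum, ← Finset.sum_sub_distrib, star_sum]
    refine Finset.sum_congr rfl fun i _ => ?_
    simp only [waveMatrix, Matrix.of_apply, Sum.elim_inr, RCLike.star_def, map_sub, map_mul,
      Complex.conj_I, Complex.conj_ofReal]
    conv_lhs => rw [← Complex.re_add_im (w i)]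
    ring

theorem waveMatrix_mulVec_eq_zero_iff {w : Fin p → ℂ} :
    waveMatrix lam v *ᵥ w = 0 ↔
      waveCLM lam v (fun i => (w i).re) = 0 ∧ waveCLM lam v (fun i => (w i).im) = 0 := by
  constructor
  · intro h
    rw [waveMatrix_mulVec] at h
    have hadd (B) := congrFun h (Sum.inl B)
    have hsub (B) := star_eq_zero.1 (congrFun h (Sum.inr B))
    simp only [Sum.elim_inl, Pi.zero_apply] at hadd
    refine ⟨funext fun B => ?_, funext fun B => mul_left_cancel₀ Complex.I_ne_zero ?_⟩ <;>
      rw [Pi.zero_apply]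
    · linear_combination (hadd B + hsub B) / 2
    · linear_combination (hadd B - hsub B) / 2
  · rintro ⟨hre, him⟩
    rw [waveMatrix_mulVec, hre, him]
    ext (B | B) <;> simp

theorem waveCLM_surjective (hΛ : LinearIndependent ℂ fun s => waveMatrix lam v s) :
    Function.Surjective (waveCLM lam v) := by
  have hrank : (waveMatrix lam v).rank = Fintype.card (Fin k ⊕ Fin k) :=
    LinearIndependent.rank_matrix hΛ
  have hrange : (waveMatrix lam v).mulVecLin.range = ⊤ :=
    Submodule.eq_top_of_finrank_eq (hrank.trans (Module.finrank_fintype_fun_eq_card ℂ).symm)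
  intro c
  obtain ⟨w, hw⟩ := LinearMap.range_eq_top.1 hrange (Sum.elim c (star c))
  rw [Matrix.mulVecLin_apply, waveMatrix_mulVec] at hw
  refine ⟨fun i => (w i).re, funext fun B => ?_⟩
  have hadd := congrFun hw (Sum.inl B)
  have hsub := star_injective (congrFun hw (Sum.inr B))
  simp only [Sum.elim_inl] at hadd
  linear_combination (hadd + hsub) / 2

theorem map_ofReal_mulVec_eq_zero_iff {ι κ : Type*} [Fintype κ] {L : Matrix ι κ ℝ} {w : κ → ℂ} :
    L.map Complex.ofReal *ᵥ w = 0 ↔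
      L *ᵥ (fun i => (w i).re) = 0 ∧ L *ᵥ (fun i => (w i).im) = 0 := by
  simp only [funext_iff, Complex.ext_iff, forall_and]
  simp [Matrix.mulVec, dotProduct]

theorem ker_mulVecLin_le_iff {ι : Type*} {L : Matrix ι (Fin p) ℝ} :
    (waveMatrix lam v).mulVecLin.ker ≤ (L.map Complex.ofReal).mulVecLin.ker ↔
      (waveCLM lam v).ker ≤ L.mulVecLin.ker := by
  constructor
  · intro h x hx
    have hx' : waveMatrix lam v *ᵥ (fun i => (x i : ℂ)) = 0 :=
      waveMatrix_mulVec_eq_zero_iff.2 ⟨by simpa using hx, by simp [← Pi.zero_def]⟩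
    have hLx : L.map Complex.ofReal *ᵥ (fun i => (x i : ℂ)) = 0 := h hx'
    simpa using (map_ofReal_mulVec_eq_zero_iff.1 hLx).1
  · intro h w hw
    obtain ⟨hre, him⟩ := waveMatrix_mulVec_eq_zero_iff.1 hw
    exact (map_ofReal_mulVec_eq_zero_iff (L := L)).2 ⟨h hre, h him⟩

theorem jetOf_mem_SQ_iff (hΛ : ∀ v ∈ U, LinearIndependent ℂ fun s => waveMatrix lam v s)
    (hξ : IsOrthogonalFrame lam ξ U) {u : (Fin p → ℝ) → (Fin q → ℝ)} {x : Fin p → ℝ}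
    (hux : u x ∈ U) : jetOf u x ∈ SQ ξ ↔ (waveCLM lam (u x)).ker ≤ (fderiv ℝ u x).ker := by
  have hspan : Submodule.span ℂ (range fun a => ξ a (u x)) =
      (waveMatrix lam (u x)).mulVecLin.ker :=
    span_range_eq_ker_mulVecLin (hΛ _ hux) (hξ.independent _ hux)
      ((add_comm _ _).trans (card_add_card_of_linearIndependent (hΛ _ hux)))
      (hξ.waveMatrix_mulVec hux)
  set L : Matrix (Fin q) (Fin p) ℝ := LinearMap.toMatrix' (fderiv ℝ u x : (Fin p → ℝ) →ₗ[ℝ] _)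
  have hL : L.mulVecLin = (fderiv ℝ u x : (Fin p → ℝ) →ₗ[ℝ] _) := Matrix.toLin'_toMatrix' _
  calc jetOf u x ∈ SQ ξ ↔ ∀ a, L.map Complex.ofReal *ᵥ ξ a (u x) = 0 := by
        simp only [jetOf, SQ, mem_ofPred_eq, funext_iff, Matrix.mulVec, dotProduct, mul_comm]
        rfl
    _ ↔ (waveMatrix lam (u x)).mulVecLin.ker ≤ (L.map Complex.ofReal).mulVecLin.ker := by
        rw [← hspan, Submodule.span_le, range_subset_iff]
        rfl
    _ ↔ (waveCLM lam (u x)).ker ≤ (fderiv ℝ u x).ker := by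
        rw [ker_mulVecLin_le_iff, hL]

variable {D : Set (Fin p → ℝ)} {u : (Fin p → ℝ) → (Fin q → ℝ)}

theorem isInvariantOn_near_iff (hΛ : ∀ v ∈ U, LinearIndependent ℂ fun s => waveMatrix lam v s)
    (hξ : IsOrthogonalFrame lam ξ U) (hD : IsOpen D) (h0 : 0 ∈ D) (huU : MapsTo u D U) :
    (∃ V ∈ 𝓝 0, V ⊆ D ∧ IsInvariantOn ξ u V) ↔
      ∀ᶠ x in 𝓝 0, (waveCLM lam (u x)).ker ≤ (fderiv ℝ u x).ker := by
  constructor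
  · rintro ⟨V, hV, hVD, hinv⟩
    filter_upwards [hV] with x hx using (jetOf_mem_SQ_iff hΛ hξ (huU (hVD hx))).1 (hinv x hx)
  · intro h
    exact ⟨_, Filter.inter_mem (hD.mem_nhds h0) h, inter_subset_left,
      fun x hx => (jetOf_mem_SQ_iff hΛ hξ (huU hx.1)).2 hx.2⟩

theorem isModeFormOn_near_iff (hD : IsOpen D) (h0 : 0 ∈ D) :
    (∃ V ∈ 𝓝 0, V ⊆ D ∧ IsModeFormOn lam u V) ↔
      ∃ (O : Set (Fin k → ℂ)) (g : (Fin k → ℂ) → Fin q → ℝ), IsOpen O ∧ ContDiffOn ℝ ∞ g O ∧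
        ∀ᶠ x in 𝓝 0, waveCLM lam (u x) x ∈ O ∧ u x = g (waveCLM lam (u x) x) := by
  simp only [waveCLM_apply]
  constructor
  · rintro ⟨V, hV, -, O, f, hO, hf, hfu⟩
    refine ⟨O, fun c α => 2 * (f c α).re, hO, contDiffOn_pi.2 fun α => contDiffOn_const.mul
      (Complex.reCLM.contDiff.comp_contDiffOn (contDiffOn_pi.1 hf α)), ?_⟩
    filter_upwards [hV] with x hx
    refine ⟨(hfu x hx).1, funext fun α => ?_⟩
    simpa [two_mul] using congrArg Complex.re ((hfu x hx).2 α)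
  · rintro ⟨O, g, hO, hg, hug⟩
    refine ⟨_, Filter.inter_mem (hD.mem_nhds h0) hug, inter_subset_left, O,
      fun c α => (g c α : ℂ) / 2, hO, contDiffOn_pi.2 fun α =>
        (Complex.ofRealCLM.contDiff.comp_contDiffOn (contDiffOn_pi.1 hg α)).div_const 2, ?_⟩
    rintro x ⟨-, hxO, hxu⟩
    refine ⟨hxO, fun α => ?_⟩
    simp [← hxu]

theorem isInvariantOn_near_iff_isModeFormOn_near (hU : IsOpen U)
    (hlam : ∀ B, ContDiffOn ℝ ∞ (lam B) U)
    (hΛ : ∀ v ∈ U, LinearIndependent ℂ fun s => waveMatrix lam v s)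
    (hξ : IsOrthogonalFrame lam ξ U) (hD : IsOpen D) (h0 : 0 ∈ D) (hu : ContDiffOn ℝ ∞ u D)
    (huU : MapsTo u D U) :
    (∃ V ∈ 𝓝 0, V ⊆ D ∧ IsInvariantOn ξ u V) ↔ ∃ V ∈ 𝓝 0, V ⊆ D ∧ IsModeFormOn lam u V := by
  rw [isInvariantOn_near_iff hΛ hξ hD h0 huU, isModeFormOn_near_iff hD h0]
  have hW : ∀ᶠ v in 𝓝 (u 0), ContDiffAt ℝ ∞ (waveCLM lam) v := by
    filter_upwards [hU.mem_nhds (huU h0)] with v hv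
      using (contDiffOn_waveCLM hlam).contDiffAt (hU.mem_nhds hv)
  have hu' : ∀ᶠ x in 𝓝 0, ContDiffAt ℝ ∞ u x := by
    filter_upwards [hD.mem_nhds h0] with x hx using hu.contDiffAt (hD.mem_nhds hx)
  constructor
  · exact exists_contDiffOn_comp_of_ker_le (by simp) hW hu' (waveCLM_surjective (hΛ _ (huU h0)))
  · rintro ⟨O, g, hO, hg, hug⟩
    have h0O : 0 ∈ O := by simpa using hug.self_of_nhds.1
    exact eventually_ker_le_of_eventually_eq_comp (hW.self_of_nhds.of_le (by simp))
      (hu'.self_of_nhds.of_le (by simp)) ((hg.contDiffAt (hO.mem_nhds h0O)).of_le (by simp))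
      (hug.mono fun x hx => hx.2)

end Modes

end QuasilinearSystem

end

theorem proposition2_general {p q m k : ℕ}
    (A : Fin p → (Fin q → ℝ) → Matrix (Fin m) (Fin q) ℝ)
    (U : Set (Fin q → ℝ)) (hU : IsOpen U)
    (hA : ∀ i μ α, DifferentiableOn ℝ (fun u => A i u μ α) U)
    (lam : Fin k → (Fin q → ℝ) → (Fin p → ℂ))
    (hlam : ∀ B, ContDiffOn ℝ ∞ (lam B) U)
    (hΛ : ∀ u ∈ U, LinearIndependent ℂ (fun s => QuasilinearSystem.waveMatrix lam u s))
    (ξ : Fin (p - 2 * k) → (Fin q → ℝ) → (Fin p → ℂ))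
    (hξ : QuasilinearSystem.IsOrthogonalFrame lam ξ U) :
    (∀ (y₀ : (Fin p → ℝ) × (Fin q → ℝ)) (M : ℕ), (q ≤ 1 ∨ k = 0 ∨ 2 ≤ M) →
      (QuasilinearSystem.GeneratesSymmetryAlgebraNear A U ξ y₀ ↔
        QuasilinearSystem.TraceConditionsNear M A lam U ξ y₀) ∧
      (QuasilinearSystem.AdmitsSymmetryAlgebraNear A lam U y₀ ↔
        QuasilinearSystem.TraceConditionsNear M A lam U ξ y₀)) ∧
    (∀ (D : Set (Fin p → ℝ)) (u : (Fin p → ℝ) → (Fin q → ℝ)), IsOpen D → 0 ∈ D →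
      ContDiffOn ℝ ∞ u D → MapsTo u D U →
      ((∃ V ∈ 𝓝 (0 : Fin p → ℝ), V ⊆ D ∧ QuasilinearSystem.IsInvariantOn ξ u V) ↔
        (∃ V ∈ 𝓝 (0 : Fin p → ℝ), V ⊆ D ∧ QuasilinearSystem.IsModeFormOn lam u V))) := by
  refine ⟨fun y₀ M hM => ?_, fun D u hD h0 hu huU =>
    QuasilinearSystem.isInvariantOn_near_iff_isModeFormOn_near hU hlam hΛ hξ hD h0 hu huU⟩
  have hgenerates : QuasilinearSystem.GeneratesSymmetryAlgebraNear A U ξ y₀ ↔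
      QuasilinearSystem.TraceConditionsNear M A lam U ξ y₀ :=
    (QuasilinearSystem.generatesSymmetryAlgebraNear_iff hU hA
      (fun B => (hlam B).differentiableOn (by simp)) hΛ hξ y₀).trans
      (QuasilinearSystem.traceConditionsNear_iff hM hΛ hξ y₀).symm
  exact ⟨hgenerates, (QuasilinearSystem.admitsSymmetryAlgebraNear_iff hU hA
    (fun B => (hlam B).differentiableOn (by simp)) hΛ hξ y₀).trans hgenerates⟩

theorem proposition2 {p q m k : ℕ}
    (A : Fin p → (Fin q → ℝ) → Matrix (Fin m) (Fin q) ℝ)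
    (U : Set (Fin q → ℝ)) (hU : IsOpen U)
    (hA : ∀ i μ α, ContDiffOn ℝ ∞ (fun u => A i u μ α) U)
    (lam : Fin k → (Fin q → ℝ) → (Fin p → ℂ))
    (hlam : QuasilinearSystem.IsWaveSystem A lam U)
    (ξ : Fin (p - 2 * k) → (Fin q → ℝ) → (Fin p → ℂ))
    (hξ : QuasilinearSystem.IsOrthogonalFrame lam ξ U)
    (hnondeg : ∀ z ∈ QuasilinearSystem.SDelta A U ∩ QuasilinearSystem.SQ ξ,
      QuasilinearSystem.IsNondegenerateAt A U z) :
    (∀ (x₀ : Fin p → ℝ), ∀ u₀ ∈ U, ∀ M : ℕ, M = q ∨ M = 2 * k →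
      (QuasilinearSystem.GeneratesSymmetryAlgebraNear A U ξ (x₀, u₀) ↔
        QuasilinearSystem.TraceConditionsNear M A lam U ξ (x₀, u₀)) ∧
      (QuasilinearSystem.AdmitsSymmetryAlgebraNear A lam U (x₀, u₀) ↔
        QuasilinearSystem.TraceConditionsNear M A lam U ξ (x₀, u₀))) ∧
    (∀ (D : Set (Fin p → ℝ)) (u : (Fin p → ℝ) → (Fin q → ℝ)), IsOpen D → 0 ∈ D →
      QuasilinearSystem.IsSolutionOn A U u D →
      ((∃ V ∈ 𝓝 (0 : Fin p → ℝ), V ⊆ D ∧ QuasilinearSystem.IsInvariantOn ξ u V) ↔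
        (∃ V ∈ 𝓝 (0 : Fin p → ℝ), V ⊆ D ∧ QuasilinearSystem.IsModeFormOn lam u V))) := by
  have general := proposition2_general A U hU (fun i μ α => (hA i μ α).differentiableOn (by simp))
    lam hlam.smooth hlam.independent ξ hξ
  exact ⟨fun x₀ u₀ _ M hM => general.1 (x₀, u₀) M (by omega),
    fun D u hD h0 hu => general.2 D u hD h0 hu.smooth hu.mapsTo⟩
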